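/- **Theorem (realization).** Let $\Lambda$ be a compact topological space, $d\ge 0$, and let $\mathbb E,\mathbb F\subset\Theta(\mathbb R^d)=\Lambda\times\mathbb R^d$ be finite-dimensional vector subbundles of the trivial bundle, i.e. families of linear subspaces of $\mathbb R^d$ whose total spaces, with the subspace topology, are locally trivial real vector bundles over $\Lambda$. Then there is a map $\mathbb A\colon\Lambda\times\mathbb Z\to GL(d,\mathbb R)$, $(\lambda,n)\mapsto\mathbb A_n(\lambda)$, such that the family $\{\mathbb A_n\colon\Lambda\to\mathcal L(\mathbb R^d)\}_{n\in\mathbb Z}$ is equicontinuous and pointwise bounded and the following holds. Let $\ell_0(\mathbb R^d)$ be the Banach space of all sequences $\phi\colon\mathbb Z\to\mathbb R^d$ with $\phi(n)\to0$ as $n\to\pm\infty$, with the supremum norm, and put $$L(\lambda)\colon\ell_0(\mathbb R^d)\to\ell_0(\mathbb R^d),\qquad (L(\lambda)\phi)(n)=\phi(n+1)-\mathbb A_n(\lambda)\phi(n).$$ Then $\lambda\mapsto L(\lambda)$ is continuous for the operator norm, every $L(\lambda)$ is a Fredholm operator, and the index bundle of $L$ is $$\operatorname{ind}(L)=[\mathbb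 E]-[\mathbb F]\in KO(\Lambda).$$ Here $KO(\Lambda)$ is the Grothendieck group of the semigroup (under $\oplus$) of stable isomorphism classes of real vector bundles of finite rank over $\Lambda$, where $\mathbb E_1,\mathbb E_2$ are stably isomorphic if $\mathbb E_1\oplus\Theta(\mathbb R^n)\cong\mathbb E_2\oplus\Theta(\mathbb R^n)$ for some $n\geq 0$. The index bundle is $\operatorname{ind}(L)=[E(L,V)]-[\Theta(V)]$, where $V\subset\ell_0(\mathbb R^d)$ is any finite-dimensional subspace with $\operatorname{im}L(\lambda)+V=\ell_0(\mathbb R^d)$ for all $\lambda\in\Lambda$ (part of the claim is that such a $V$ exists), and $E(L,V)=\{(\lambda,\phi)\in\Lambda\times\ell_0(\mathbb R^d): L(\lambda)\phi\in V\}$, which is a vector bundle over $\Lambda$; the class does not depend on the choice of $V$. -/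

import Mathlib

open Bundle Topology Filter
open scoped ZeroAtInfty

/-! ### Real vector bundles of finite, locally constant rank -/

/-- The total space `{(x, v) | v ∈ Fiber x}` of a family of vector spaces. (The first argument of
`Bundle.TotalSpace` is a dummy label; the topology is always given explicitly.) -/
abbrev FamTotal {Λ : Type*} (Fiber : Λ → Type) : Type _ := TotalSpace Unit Fiber

/-- Local triviality of a family of real vector spaces whose total space is topologized: the
projection is continuous, and every point of the base has an open neighbourhood `U` over which the
total space is homeomorphic to `U × ℝⁿ`, by a homeomorphism that commutes with the projections and
is linear on each fibre. The rank `n` may differ between different components of the base. -/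
def IsVectorBundle {Λ : Type*} [TopologicalSpace Λ] (Fiber : Λ → Type)
    [∀ x, AddCommGroup (Fiber x)] [∀ x, Module ℝ (Fiber x)]
    [TopologicalSpace (FamTotal Fiber)] : Prop :=
  Continuous (fun p : FamTotal Fiber => p.proj) ∧
  ∀ x₀ : Λ, ∃ U : Set Λ, IsOpen U ∧ x₀ ∈ U ∧ ∃ (n : ℕ)
    (φ : ∀ x : U, Fiber x ≃ₗ[ℝ] EuclideanSpace ℝ (Fin n)),
    Continuous (fun p : {p : FamTotal Fiber // p.proj ∈ U} => φ ⟨p.1.proj, p.2⟩ p.1.snd) ∧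
    Continuous (fun q : U × EuclideanSpace ℝ (Fin n) =>
      (⟨q.1, (φ q.1).symm q.2⟩ : FamTotal Fiber))

/-- A real vector bundle of finite rank over `Λ`. -/
structure RealVectorBundle (Λ : Type*) [TopologicalSpace Λ] where
  Fiber : Λ → Type
  [addCommGroup : ∀ x, AddCommGroup (Fiber x)]
  [module : ∀ x, Module ℝ (Fiber x)]
  [topology : TopologicalSpace (FamTotal Fiber)]
  isVectorBundle : IsVectorBundle Fiber

namespace RealVectorBundle

attribute [instance] RealVectorBundle.addCommGroup RealVectorBundle.module
  RealVectorBundle.topology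

variable {Λ : Type*} [TopologicalSpace Λ]

/-- The total space of a vector bundle. -/
abbrev Total (E : RealVectorBundle Λ) : Type _ := FamTotal E.Fiber

/-- Isomorphisms of vector bundles over the identity of the base: fibrewise linear isomorphisms
that form a homeomorphism of the total spaces. -/
structure Iso (E F : RealVectorBundle Λ) where
  equiv : ∀ x, E.Fiber x ≃ₗ[ℝ] F.Fiber x
  continuous_toFun : Continuous (fun p : E.Total => (⟨p.proj, equiv p.proj p.snd⟩ : F.Total))
  continuous_invFun :
    Continuous (fun p : F.Total => (⟨p.proj, (equiv p.proj).symm p.snd⟩ : E.Total))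

/-- The topology on the total space of the trivial bundle `Λ × V`. -/
@[reducible] def trivialTopology (Λ : Type*) [TopologicalSpace Λ] (V : Type)
    [TopologicalSpace V] : TopologicalSpace (FamTotal fun _ : Λ => V) :=
  TopologicalSpace.induced (fun p => (p.proj, p.snd)) inferInstance

theorem isVectorBundle_trivial (Λ : Type*) [TopologicalSpace Λ] (V : Type)
    [NormedAddCommGroup V] [NormedSpace ℝ V] [FiniteDimensional ℝ V] :
    @IsVectorBundle Λ _ (fun _ => V) _ _ (trivialTopology Λ V) := by
  let _ := trivialTopology Λ V
  have hd : Continuous (fun p : FamTotal (fun _ : Λ => V) => (p.proj, p.snd)) :=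
    continuous_induced_dom
  refine ⟨hd.fst, fun x₀ => ⟨Set.univ, isOpen_univ, trivial, Module.finrank ℝ V, ?_⟩⟩
  let e : V ≃L[ℝ] EuclideanSpace ℝ (Fin (Module.finrank ℝ V)) :=
    ContinuousLinearEquiv.ofFinrankEq (by simp)
  refine ⟨fun _ => e.toLinearEquiv, ?_, ?_⟩
  · exact e.continuous.comp (hd.snd.comp continuous_subtype_val)
  · refine continuous_induced_rng.2 ?_
    exact (continuous_subtype_val.comp continuous_fst).prodMk
      (e.symm.continuous.comp continuous_snd)

/-- The trivial bundle `Θ(V)` with fibre a finite-dimensional normed space `V`. -/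
def trivialBundle (Λ : Type*) [TopologicalSpace Λ] (V : Type)
    [NormedAddCommGroup V] [NormedSpace ℝ V] [FiniteDimensional ℝ V] : RealVectorBundle Λ where
  Fiber _ := V
  topology := trivialTopology Λ V
  isVectorBundle := isVectorBundle_trivial Λ V

/-- The topology on the total space of the direct sum, as the fibre product of the total spaces. -/
@[reducible] def sumTopology (E F : RealVectorBundle Λ) :
    TopologicalSpace (FamTotal fun x => E.Fiber x × F.Fiber x) :=
  TopologicalSpace.induced
    (fun p => ((⟨p.proj, p.snd.1⟩ : E.Total), (⟨p.proj, p.snd.2⟩ : F.Total))) inferInstance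

theorem isVectorBundle_sum (E F : RealVectorBundle Λ) :
    @IsVectorBundle Λ _ (fun x => E.Fiber x × F.Fiber x) _ _ (sumTopology E F) := by
  let _ := sumTopology E F
  have hd : Continuous (fun p : FamTotal (fun x => E.Fiber x × F.Fiber x) =>
      ((⟨p.proj, p.snd.1⟩ : E.Total), (⟨p.proj, p.snd.2⟩ : F.Total))) := continuous_induced_dom
  refine ⟨E.isVectorBundle.1.comp hd.fst, fun x₀ => ?_⟩
  obtain ⟨U, hU, hxU, n, φ, hφ, hφ'⟩ := E.isVectorBundle.2 x₀
  obtain ⟨W, hW, hxW, m, ψ, hψ, hψ'⟩ := F.isVectorBundle.2 x₀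
  let e : (EuclideanSpace ℝ (Fin n) × EuclideanSpace ℝ (Fin m)) ≃L[ℝ]
      EuclideanSpace ℝ (Fin (n + m)) := ContinuousLinearEquiv.ofFinrankEq (by simp)
  refine ⟨U ∩ W, hU.inter hW, ⟨hxU, hxW⟩, n + m,
    fun x => ((φ ⟨x, x.2.1⟩).prodCongr (ψ ⟨x, x.2.2⟩)).trans e.toLinearEquiv, ?_, ?_⟩
  · refine e.continuous.comp (Continuous.prodMk ?_ ?_)
    · exact hφ.comp (Continuous.subtype_mk (hd.fst.comp continuous_subtype_val)
        fun p => p.2.1)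
    · exact hψ.comp (Continuous.subtype_mk (hd.snd.comp continuous_subtype_val)
        fun p => p.2.2)
  · refine continuous_induced_rng.2 (Continuous.prodMk ?_ ?_)
    · exact hφ'.comp (Continuous.prodMk
        (Continuous.subtype_mk (continuous_subtype_val.comp continuous_fst) fun q => q.1.2.1)
        ((e.symm.continuous.comp continuous_snd).fst))
    · exact hψ'.comp (Continuous.prodMk
        (Continuous.subtype_mk (continuous_subtype_val.comp continuous_fst) fun q => q.1.2.2)
        ((e.symm.continuous.comp continuous_snd).snd))

/-- The direct (Whitney) sum of two vector bundles. -/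
def sum (E F : RealVectorBundle Λ) : RealVectorBundle Λ where
  Fiber x := E.Fiber x × F.Fiber x
  topology := sumTopology E F
  isVectorBundle := isVectorBundle_sum E F

theorem continuous_sum_fst (E F : RealVectorBundle Λ) :
    Continuous (fun p : (E.sum F).Total => (⟨p.proj, p.snd.1⟩ : E.Total)) :=
  (continuous_induced_dom (t := inferInstance)
    (f := fun p : (E.sum F).Total =>
      ((⟨p.proj, p.snd.1⟩ : E.Total), (⟨p.proj, p.snd.2⟩ : F.Total)))).fst

theorem continuous_sum_snd (E F : RealVectorBundle Λ) :
    Continuous (fun p : (E.sum F).Total => (⟨p.proj, p.snd.2⟩ : F.Total)) :=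
  (continuous_induced_dom (t := inferInstance)
    (f := fun p : (E.sum F).Total =>
      ((⟨p.proj, p.snd.1⟩ : E.Total), (⟨p.proj, p.snd.2⟩ : F.Total)))).snd

theorem continuous_sum_mk {E F : RealVectorBundle Λ} {Z : Type*} [TopologicalSpace Z]
    {b : Z → Λ} {f : ∀ z, E.Fiber (b z)} {g : ∀ z, F.Fiber (b z)}
    (hf : Continuous fun z => (⟨b z, f z⟩ : E.Total))
    (hg : Continuous fun z => (⟨b z, g z⟩ : F.Total)) :
    Continuous fun z => (⟨b z, (f z, g z)⟩ : (E.sum F).Total) :=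
  continuous_induced_rng.2 (hf.prodMk hg)

theorem continuous_trivial_mk {V : Type}
    [NormedAddCommGroup V] [NormedSpace ℝ V] [FiniteDimensional ℝ V]
    {Z : Type*} [TopologicalSpace Z] {b : Z → Λ} {f : Z → V}
    (hb : Continuous b) (hf : Continuous f) :
    Continuous fun z => (⟨b z, f z⟩ : (trivialBundle Λ V).Total) :=
  continuous_induced_rng.2 (hb.prodMk hf)

theorem continuous_trivial_snd (V : Type)
    [NormedAddCommGroup V] [NormedSpace ℝ V] [FiniteDimensional ℝ V] :
    Continuous fun p : (trivialBundle Λ V).Total => (p.snd : V) :=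
  (continuous_induced_dom (t := inferInstance)
    (f := fun p : (trivialBundle Λ V).Total => (p.proj, (p.snd : V)))).snd

namespace Iso

variable {E E' F F' G : RealVectorBundle Λ}

/-- The identity isomorphism. -/
def refl (E : RealVectorBundle Λ) : Iso E E where
  equiv _ := LinearEquiv.refl ℝ _
  continuous_toFun := continuous_id
  continuous_invFun := continuous_id

/-- The inverse isomorphism. -/
def symm (i : Iso E F) : Iso F E where
  equiv x := (i.equiv x).symm
  continuous_toFun := i.continuous_invFun
  continuous_invFun := i.continuous_toFun

/-- Composition of isomorphisms. -/
def trans (i : Iso E F) (j : Iso F G) : Iso E G where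
  equiv x := (i.equiv x).trans (j.equiv x)
  continuous_toFun := j.continuous_toFun.comp i.continuous_toFun
  continuous_invFun := i.continuous_invFun.comp j.continuous_invFun

/-- The direct sum of two isomorphisms. -/
def sumCongr (i : Iso E E') (j : Iso F F') : Iso (E.sum F) (E'.sum F') where
  equiv x := (i.equiv x).prodCongr (j.equiv x)
  continuous_toFun := continuous_sum_mk
    (i.continuous_toFun.comp (continuous_sum_fst E F))
    (j.continuous_toFun.comp (continuous_sum_snd E F))
  continuous_invFun := continuous_sum_mk
    (i.continuous_invFun.comp (continuous_sum_fst E' F'))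
    (j.continuous_invFun.comp (continuous_sum_snd E' F'))

/-- Commutativity of the direct sum. -/
def sumComm (E F : RealVectorBundle Λ) : Iso (E.sum F) (F.sum E) where
  equiv x := LinearEquiv.prodComm ℝ (E.Fiber x) (F.Fiber x)
  continuous_toFun := continuous_sum_mk (continuous_sum_snd E F) (continuous_sum_fst E F)
  continuous_invFun := continuous_sum_mk (continuous_sum_snd F E) (continuous_sum_fst F E)

/-- Associativity of the direct sum. -/
def sumAssoc (E F G : RealVectorBundle Λ) : Iso ((E.sum F).sum G) (E.sum (F.sum G)) where
  equiv x := LinearEquiv.prodAssoc ℝ (E.Fiber x) (F.Fiber x) (G.Fiber x)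
  continuous_toFun :=
    continuous_sum_mk (E := E) (F := F.sum G) (b := fun p : ((E.sum F).sum G).Total => p.proj)
      (f := fun p => p.snd.1.1) (g := fun p => (p.snd.1.2, p.snd.2))
      ((continuous_sum_fst E F).comp (continuous_sum_fst (E.sum F) G))
      (continuous_sum_mk ((continuous_sum_snd E F).comp (continuous_sum_fst (E.sum F) G))
        (continuous_sum_snd (E.sum F) G))
  continuous_invFun :=
    continuous_sum_mk (E := E.sum F) (F := G) (b := fun p : (E.sum (F.sum G)).Total => p.proj)
      (f := fun p => (p.snd.1, p.snd.2.1)) (g := fun p => p.snd.2.2)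
      (continuous_sum_mk (continuous_sum_fst E (F.sum G))
        ((continuous_sum_fst F G).comp (continuous_sum_snd E (F.sum G))))
      ((continuous_sum_snd F G).comp (continuous_sum_snd E (F.sum G)))

/-- The trivial bundle of rank zero is neutral for the direct sum. -/
def zeroSum (E : RealVectorBundle Λ) :
    Iso ((trivialBundle Λ (EuclideanSpace ℝ (Fin 0))).sum E) E where
  equiv x :=
    { toFun := fun v => v.2
      map_add' := fun _ _ => rfl
      map_smul' := fun _ _ => rfl
      invFun := fun v => ((0 : EuclideanSpace ℝ (Fin 0)), v)
      left_inv := fun v => Prod.ext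
        (Subsingleton.elim (α := EuclideanSpace ℝ (Fin 0)) _ _) rfl
      right_inv := fun _ => rfl }
  continuous_toFun := continuous_sum_snd _ E
  continuous_invFun :=
    continuous_sum_mk (E := trivialBundle Λ (EuclideanSpace ℝ (Fin 0))) (F := E)
      (b := fun p : E.Total => p.proj) (f := fun _ => (0 : EuclideanSpace ℝ (Fin 0)))
      (g := fun p => p.snd)
      (continuous_trivial_mk E.isVectorBundle.1 continuous_const) continuous_id

/-- `Θ(ℝⁿ) ⊕ Θ(ℝᵐ) ≅ Θ(ℝⁿ⁺ᵐ)`. -/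
noncomputable def trivialSum (Λ : Type*) [TopologicalSpace Λ] (n m : ℕ) :
    Iso ((trivialBundle Λ (EuclideanSpace ℝ (Fin n))).sum
        (trivialBundle Λ (EuclideanSpace ℝ (Fin m))))
      (trivialBundle Λ (EuclideanSpace ℝ (Fin (n + m)))) :=
  let e : (EuclideanSpace ℝ (Fin n) × EuclideanSpace ℝ (Fin m)) ≃L[ℝ]
      EuclideanSpace ℝ (Fin (n + m)) := ContinuousLinearEquiv.ofFinrankEq (by simp)
  { equiv := fun _ => e.toLinearEquiv
    continuous_toFun := continuous_trivial_mk
      (RealVectorBundle.sum _ _).isVectorBundle.1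
      (e.continuous.comp (Continuous.prodMk
        ((continuous_trivial_snd _).comp (continuous_sum_fst _ _))
        ((continuous_trivial_snd _).comp (continuous_sum_snd _ _))))
    continuous_invFun :=
      continuous_sum_mk (E := trivialBundle Λ (EuclideanSpace ℝ (Fin n)))
        (F := trivialBundle Λ (EuclideanSpace ℝ (Fin m)))
        (b := fun p : (trivialBundle Λ (EuclideanSpace ℝ (Fin (n + m)))).Total => p.proj)
        (f := fun p => (e.symm p.snd).1) (g := fun p => (e.symm p.snd).2)
        (continuous_trivial_mk (trivialBundle Λ _).isVectorBundle.1
          ((e.symm.continuous.comp (continuous_trivial_snd _)).fst))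
        (continuous_trivial_mk (trivialBundle Λ _).isVectorBundle.1
          ((e.symm.continuous.comp (continuous_trivial_snd _)).snd)) }

end Iso

/-- Stable isomorphism: `E ⊕ Θ(ℝⁿ) ≅ F ⊕ Θ(ℝⁿ)` for some `n`. -/
def StablyIso (E F : RealVectorBundle Λ) : Prop :=
  ∃ n : ℕ, Nonempty (Iso (E.sum (trivialBundle Λ (EuclideanSpace ℝ (Fin n))))
    (F.sum (trivialBundle Λ (EuclideanSpace ℝ (Fin n)))))

theorem Iso.stablyIso {E F : RealVectorBundle Λ} (i : Iso E F) : StablyIso E F :=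
  ⟨0, ⟨i.sumCongr (Iso.refl _)⟩⟩

/-- Adding a further trivial summand preserves an isomorphism. -/
noncomputable def Iso.stabilize {E F : RealVectorBundle Λ} {n : ℕ}
    (i : Iso (E.sum (trivialBundle Λ (EuclideanSpace ℝ (Fin n))))
      (F.sum (trivialBundle Λ (EuclideanSpace ℝ (Fin n))))) (m : ℕ) :
    Iso (E.sum (trivialBundle Λ (EuclideanSpace ℝ (Fin (n + m)))))
      (F.sum (trivialBundle Λ (EuclideanSpace ℝ (Fin (n + m))))) :=
  (((Iso.refl E).sumCongr (Iso.trivialSum Λ n m).symm).trans (Iso.sumAssoc _ _ _).symm).trans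
    ((i.sumCongr (Iso.refl _)).trans
      ((Iso.sumAssoc _ _ _).trans ((Iso.refl F).sumCongr (Iso.trivialSum Λ n m))))

theorem stablyIso_equivalence : Equivalence (StablyIso (Λ := Λ)) where
  refl E := (Iso.refl E).stablyIso
  symm := fun ⟨n, ⟨i⟩⟩ => ⟨n, ⟨i.symm⟩⟩
  trans := by
    rintro E F G ⟨n, ⟨i⟩⟩ ⟨m, ⟨j⟩⟩
    have j' := j.stabilize n
    rw [Nat.add_comm m n] at j'
    exact ⟨n + m, ⟨(i.stabilize m).trans j'⟩⟩

theorem StablyIso.add_right {E F : RealVectorBundle Λ} (h : StablyIso E F)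
    (G : RealVectorBundle Λ) : StablyIso (E.sum G) (F.sum G) := by
  obtain ⟨n, ⟨i⟩⟩ := h
  let c (H : RealVectorBundle Λ) :
      Iso ((H.sum G).sum (trivialBundle Λ (EuclideanSpace ℝ (Fin n))))
        ((H.sum (trivialBundle Λ (EuclideanSpace ℝ (Fin n)))).sum G) :=
    ((Iso.sumAssoc _ _ _).trans ((Iso.refl H).sumCongr (Iso.sumComm _ _))).trans
      (Iso.sumAssoc _ _ _).symm
  exact ⟨n, ⟨((c E).trans (i.sumCongr (Iso.refl G))).trans (c F).symm⟩⟩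

theorem StablyIso.sum {E E' F F' : RealVectorBundle Λ} (h : StablyIso E E')
    (k : StablyIso F F') : StablyIso (E.sum F) (E'.sum F') :=
  stablyIso_equivalence.trans (h.add_right F)
    (stablyIso_equivalence.trans (Iso.sumComm E' F).stablyIso
      (stablyIso_equivalence.trans (k.add_right E') (Iso.sumComm F' E').stablyIso))

/-- The setoid of stable isomorphism. -/
def stableSetoid (Λ : Type*) [TopologicalSpace Λ] : Setoid (RealVectorBundle Λ) :=
  ⟨StablyIso, stablyIso_equivalence⟩

end RealVectorBundle

/-! ### The group `KO(Λ)` -/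

/-- Stable isomorphism classes of real vector bundles of finite rank over `Λ`. -/
def StableClass (Λ : Type*) [TopologicalSpace Λ] : Type _ :=
  Quotient (RealVectorBundle.stableSetoid Λ)

/-- The commutative semigroup of stable classes under the direct sum; its zero is `Θ(ℝ⁰)`. -/
noncomputable instance StableClass.instAddCommMonoid (Λ : Type*) [TopologicalSpace Λ] :
    AddCommMonoid (StableClass Λ) where
  add := Quotient.map₂ RealVectorBundle.sum (fun _ _ h _ _ k => h.sum k)
  zero := Quotient.mk _ (RealVectorBundle.trivialBundle Λ (EuclideanSpace ℝ (Fin 0)))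
  add_assoc := by
    rintro ⟨E⟩ ⟨F⟩ ⟨G⟩
    exact Quotient.sound (RealVectorBundle.Iso.sumAssoc E F G).stablyIso
  add_comm := by
    rintro ⟨E⟩ ⟨F⟩
    exact Quotient.sound (RealVectorBundle.Iso.sumComm E F).stablyIso
  zero_add := by
    rintro ⟨E⟩
    exact Quotient.sound (RealVectorBundle.Iso.zeroSum E).stablyIso
  add_zero := by
    rintro ⟨E⟩
    exact Quotient.sound
      ((RealVectorBundle.Iso.sumComm E _).trans (RealVectorBundle.Iso.zeroSum E)).stablyIso
  nsmul := @nsmulRec _ ⟨Quotient.mk _ (RealVectorBundle.trivialBundle Λ (EuclideanSpace ℝ (Fin 0)))⟩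
    ⟨Quotient.map₂ RealVectorBundle.sum (fun _ _ h _ _ k => h.sum k)⟩

/-- `KO(Λ)`: the Grothendieck group of the semigroup of stable classes of vector bundles. -/
abbrev KO (Λ : Type*) [TopologicalSpace Λ] : Type _ :=
  Algebra.GrothendieckAddGroup (StableClass Λ)

/-- The class `[E]` of a vector bundle in `KO(Λ)`. -/
noncomputable def RealVectorBundle.toKO {Λ : Type*} [TopologicalSpace Λ]
    (E : RealVectorBundle Λ) : KO Λ :=
  Algebra.GrothendieckAddGroup.of (Quotient.mk (RealVectorBundle.stableSetoid Λ) E)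

/-! ### Subbundles of the product `Λ × X` and the index bundle -/

section Subbundle

variable {Λ : Type*} [TopologicalSpace Λ] {X Y : Type}
  [NormedAddCommGroup X] [NormedSpace ℝ X] [NormedAddCommGroup Y] [NormedSpace ℝ Y]

/-- The subspace topology on `{(x, v) | v ∈ S x} ⊆ Λ × X`. -/
@[reducible] def subTopology (S : Λ → Submodule ℝ X) :
    TopologicalSpace (FamTotal fun x => S x) :=
  TopologicalSpace.induced (fun p => (p.proj, (p.snd : X))) inferInstance

/-- `S` is a finite-dimensional subbundle of `Θ(X) = Λ × X`: the set `{(x, v) | v ∈ S x}` with the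
subspace topology is a vector bundle. -/
def IsSubbundle (S : Λ → Submodule ℝ X) : Prop :=
  @IsVectorBundle Λ _ (fun x => S x) _ _ (subTopology S)

/-- A finite-dimensional subbundle of `Θ(X)` as a vector bundle. -/
def IsSubbundle.toBundle {S : Λ → Submodule ℝ X} (hS : IsSubbundle S) : RealVectorBundle Λ where
  Fiber x := S x
  topology := subTopology S
  isVectorBundle := hS

/-- `V` is transversal to the family `L`: `im (L x) + V = Y` for all `x`. -/
def IsTransversal (L : Λ → X →L[ℝ] Y) (V : Submodule ℝ Y) : Prop :=
  ∀ x, LinearMap.range (L x : X →ₗ[ℝ] Y) ⊔ V = ⊤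

/-- The fibres `L x ⁻¹ (V)` of `E(L, V)`. -/
def transversalPreimage (L : Λ → X →L[ℝ] Y) (V : Submodule ℝ Y) (x : Λ) : Submodule ℝ X :=
  V.comap (L x : X →ₗ[ℝ] Y)

/-- `κ ∈ KO(Λ)` is the index bundle of the family `L`: there are finite-dimensional subspaces
transversal to `L`, and for each such `V` the family `E(L, V)` is a vector bundle with
`κ = [E(L, V)] - [Θ(V)]`, independently of the choice of `V`. -/
def IsIndexBundle (L : Λ → X →L[ℝ] Y) (κ : KO Λ) : Prop :=
  (∃ V : Submodule ℝ Y, FiniteDimensional ℝ V ∧ IsTransversal L V) ∧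
  ∀ (V : Submodule ℝ Y) [FiniteDimensional ℝ V], IsTransversal L V →
    ∃ h : IsSubbundle (transversalPreimage L V),
      κ = h.toBundle.toKO - (RealVectorBundle.trivialBundle Λ V).toKO

theorem IsIndexBundle.unique {L : Λ → X →L[ℝ] Y} {κ κ' : KO Λ}
    (h : IsIndexBundle L κ) (h' : IsIndexBundle L κ') : κ = κ' := by
  obtain ⟨V, hV, hT⟩ := h.1
  obtain ⟨_, e⟩ := h.2 V hT
  obtain ⟨_, e'⟩ := h'.2 V hT
  exact e.trans e'.symm

end Subbundle

/-! ### Linear discrete vector fields and their operators on `ℓ₀(ℝᵈ)` -/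

/-- `ℝᵈ` with the Euclidean norm. -/
abbrev Rd (d : ℕ) : Type := EuclideanSpace ℝ (Fin d)

/-- `ℓ₀(ℝᵈ)`: sequences `ℤ → ℝᵈ` with limit `0` at `±∞`, with the supremum norm. -/
abbrev EllZero (d : ℕ) : Type := C₀(ℤ, Rd d)

/-- The left shift `(S φ)(n) = φ (n + 1)` on `ℓ₀(ℝᵈ)`. -/
noncomputable def leftShift (d : ℕ) : EllZero d →L[ℝ] EllZero d :=
  LinearMap.mkContinuous
    { toFun := fun φ =>
        { toFun := fun n => φ (n + 1)
          continuous_toFun := continuous_of_discreteTopology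
          zero_at_infty' := φ.zero_at_infty'.comp
            (Homeomorph.addRight (1 : ℤ)).isClosedEmbedding.tendsto_cocompact }
      map_add' := fun _ _ => rfl
      map_smul' := fun _ _ => rfl }
    1 (fun φ => by
      rw [one_mul, ← ZeroAtInftyContinuousMap.norm_toBCF_eq_norm,
        BoundedContinuousFunction.norm_le (norm_nonneg _)]
      intro n
      rw [← ZeroAtInftyContinuousMap.norm_toBCF_eq_norm]
      exact φ.toBCF.norm_coe_le_norm (n + 1))

@[simp] theorem leftShift_apply (d : ℕ) (φ : EllZero d) (n : ℤ) :
    leftShift d φ n = φ (n + 1) := rfl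

/-- The operator `(N φ)(n) = a n (φ n)` on `ℓ₀(ℝᵈ)` of a bounded sequence `a` of matrices. -/
noncomputable def nemitski {d : ℕ} (a : ℤ → Rd d →L[ℝ] Rd d) (ha : ∃ C, ∀ n, ‖a n‖ ≤ C) :
    EllZero d →L[ℝ] EllZero d :=
  LinearMap.mkContinuousOfExistsBound
    { toFun := fun φ =>
        { toFun := fun n => a n (φ n)
          continuous_toFun := continuous_of_discreteTopology
          zero_at_infty' := by
            obtain ⟨C, hC⟩ := ha
            have h := (tendsto_zero_iff_norm_tendsto_zero.1 φ.zero_at_infty').const_mul C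
            rw [mul_zero] at h
            exact squeeze_zero_norm (fun n => (a n).le_of_opNorm_le (hC n) (φ n)) h }
      map_add' := fun φ ψ => by ext1 n; exact map_add (a n) (φ n) (ψ n)
      map_smul' := fun c φ => by ext1 n; exact map_smul (a n) c (φ n) }
    (by
      obtain ⟨C, hC⟩ := ha
      have hC0 : 0 ≤ C := (norm_nonneg _).trans (hC 0)
      refine ⟨C, fun φ => ?_⟩
      rw [← ZeroAtInftyContinuousMap.norm_toBCF_eq_norm,
        BoundedContinuousFunction.norm_le (mul_nonneg hC0 (norm_nonneg _))]
      intro n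
      refine ((a n).le_of_opNorm_le (hC n) (φ n)).trans (mul_le_mul_of_nonneg_left ?_ hC0)
      rw [← ZeroAtInftyContinuousMap.norm_toBCF_eq_norm]
      exact φ.toBCF.norm_coe_le_norm n)

@[simp] theorem nemitski_apply {d : ℕ} (a : ℤ → Rd d →L[ℝ] Rd d) (ha : ∃ C, ∀ n, ‖a n‖ ≤ C)
    (φ : EllZero d) (n : ℤ) : nemitski a ha φ n = a n (φ n) := rfl

/-- A parametrized linear discrete vector field `𝔸 : Λ × ℤ → L(ℝᵈ)`: the maps `𝔸ₙ : Λ → L(ℝᵈ)`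
form an equicontinuous and pointwise bounded family. -/
structure LinearVectorField (Λ : Type*) [TopologicalSpace Λ] (d : ℕ) where
  toFun : Λ → ℤ → (Rd d →L[ℝ] Rd d)
  equicontinuous : Equicontinuous fun (n : ℤ) (x : Λ) => toFun x n
  pointwise_bounded : ∀ x, ∃ C, ∀ n, ‖toFun x n‖ ≤ C

/-- The family of operators `L(x) = S - N_{𝔸(x)}` on `ℓ₀(ℝᵈ)`. -/
noncomputable def LinearVectorField.operator {Λ : Type*} [TopologicalSpace Λ] {d : ℕ}
    (A : LinearVectorField Λ d) (x : Λ) : EllZero d →L[ℝ] EllZero d :=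
  leftShift d - nemitski (A.toFun x) (A.pointwise_bounded x)

/-!
The proof rests on the exponential dichotomy of one explicit vector field. Let `P x` and `Q x` be
the orthogonal projections onto `E x` and `F x`; they are continuous in `x`
(`IsSubbundle.continuous_starProjection`). For a projection `P` let `hyperbolic P` be the operator
that is `1/2` on the image and `2` on the kernel of `P`. The coefficients `switch (P x) (Q x)` are
`hyperbolic (P x)` for `n ≥ 0` and `hyperbolic (Q x)` for `n < 0`. A homogeneous solution that
decays in forward time starts in `E x`, and one that decays in backward time ends in `(F x)^⊥`
(`forward_solution`, `backward_solution`).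

With constant coefficients `hyperbolic P` the inhomogeneous equation is solved on all of `ℤ` by the
operator `green P`, which is continuous in `P`. Hence each `φ` with image `ψ` under the
switching operator is given for `n ≥ 0` by `green P ψ` plus a decaying solution starting at some
`p ∈ E x`, and for `n ≤ 0` by `green Q ψ` plus a decaying solution ending at some `q ∈ (F x)^⊥`; the
only condition is that the two halves agree at the origin, `p - q = jump P Q ψ` (`eq_glue`,
`switchOp_glue_apply`). Ignoring this condition gives a quasi-inverse, whose defect lives at the
index `-1`; so the operators are Fredholm and the sequences supported at `-1` are transversal to
them.

For a transversal `V` the bundle `E(L, V)` is therefore isomorphic to the bundle of triples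
`(v, p, q)` with `v ∈ V`, `p ∈ E x`, `q ∈ (F x)^⊥` and `p - q = jump v` (`solutionEquiv`). This is the
kernel of a family of linear maps between finite-dimensional spaces, onto by transversality
(`exists_sub_sub_jump`). A continuous family of right inverses exists over any base
(`exists_continuous_rightInverse`), and a splitting of `V × ℝᵈ × ℝᵈ` shows that the class of the
kernel is `[E] + [Θ(V)] - [F]` (`isSubbundle_matchingSpace`).
-/

/-! ### Continuous families of operators -/

section Families

variable {Λ : Type*} [TopologicalSpace Λ]

theorem Continuous.ringInverse {R : Type*} [NormedRing R] [HasSummableGeomSeries R]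
    {f : Λ → R} (hf : Continuous f) (hu : ∀ x, IsUnit (f x)) :
    Continuous fun x => Ring.inverse (f x) :=
  continuous_iff_continuousAt.2 fun x => by
    obtain ⟨u, hu⟩ := hu x
    exact ContinuousAt.comp (f := f) (hu ▸ NormedRing.inverse_continuousAt u) hf.continuousAt

theorem Continuous.clm_sub {X Y : Type*} [NormedAddCommGroup X] [NormedSpace ℝ X]
    [NormedAddCommGroup Y] [NormedSpace ℝ Y] {f g : Λ → X →L[ℝ] Y} (hf : Continuous f)
    (hg : Continuous g) : Continuous fun x => f x - g x :=
  hf.sub hg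

theorem Continuous.clm_add {X Y : Type*} [NormedAddCommGroup X] [NormedSpace ℝ X]
    [NormedAddCommGroup Y] [NormedSpace ℝ Y] {f g : Λ → X →L[ℝ] Y} (hf : Continuous f)
    (hg : Continuous g) : Continuous fun x => f x + g x :=
  hf.add hg

variable {W H : Type*} [NormedAddCommGroup W] [NormedSpace ℝ W] [FiniteDimensional ℝ W]
  [NormedAddCommGroup H] [InnerProductSpace ℝ H] [FiniteDimensional ℝ H]

theorem ContinuousLinearMap.isUnit_comp_adjoint [CompleteSpace H] {K : Type*}
    [NormedAddCommGroup K] [InnerProductSpace ℝ K] [CompleteSpace K] (D : K →L[ℝ] H)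
    (hD : Function.Surjective D) : IsUnit (D ∘L D.adjoint) := by
  rw [ContinuousLinearMap.isUnit_iff_isUnit_toLinearMap, LinearMap.isUnit_iff_ker_eq_bot,
    ContinuousLinearMap.ker_self_comp_adjoint, ← ContinuousLinearMap.orthogonal_range,
    LinearMap.range_eq_top.2 hD, Submodule.top_orthogonal_eq_bot]

/-- A continuous family of surjections onto a finite-dimensional space has a continuous family of
right inverses, over an arbitrary base: `D†(DD†)⁻¹` for any Euclidean structure on the source. -/
theorem exists_continuous_rightInverse {D : Λ → W →L[ℝ] H} (hD : Continuous D)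
    (hs : ∀ x, Function.Surjective (D x)) :
    ∃ R : Λ → H →L[ℝ] W, Continuous R ∧ ∀ x h, D x (R x h) = h := by
  have := FiniteDimensional.complete ℝ H
  let e : EuclideanSpace ℝ (Fin (Module.finrank ℝ W)) ≃L[ℝ] W :=
    ContinuousLinearEquiv.ofFinrankEq (by simp)
  let D' x := D x ∘L (e : EuclideanSpace ℝ (Fin (Module.finrank ℝ W)) →L[ℝ] W)
  have hD' : Continuous D' := hD.clm_comp continuous_const
  have hu x : IsUnit (D' x ∘L (D' x).adjoint) :=
    (D' x).isUnit_comp_adjoint ((hs x).comp e.surjective)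
  have ha : Continuous fun x => (D' x).adjoint :=
    ContinuousLinearMap.adjoint.continuous.comp hD'
  refine ⟨fun x => (e : _ →L[ℝ] W) ∘L (D' x).adjoint ∘L Ring.inverse (D' x ∘L (D' x).adjoint),
    continuous_const.clm_comp (ha.clm_comp ((hD'.clm_comp ha).ringInverse hu)), fun x h => ?_⟩
  exact congrArg (fun T : H →L[ℝ] H => T h) (Ring.mul_inverse_cancel _ (hu x))

theorem Submodule.starProjection_idem {X : Type*} [NormedAddCommGroup X] [InnerProductSpace ℝ X]
    (E : Submodule ℝ X) [E.HasOrthogonalProjection] (v : X) :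
    E.starProjection (E.starProjection v) = E.starProjection v :=
  Submodule.starProjection_eq_self_iff.2 (E.starProjection_apply_mem v)

end Families

/-! ### Subbundles as images of continuous families of projections -/

section Bundles

variable {Λ : Type*} [TopologicalSpace Λ]

/-- Local triviality passes along fibrewise isomorphisms that form a homeomorphism of the total
spaces. -/
theorem IsVectorBundle.of_equiv {A B : Λ → Type}
    [∀ x, AddCommGroup (A x)] [∀ x, Module ℝ (A x)] [TopologicalSpace (FamTotal A)]
    [∀ x, AddCommGroup (B x)] [∀ x, Module ℝ (B x)] [TopologicalSpace (FamTotal B)]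
    (hB : IsVectorBundle B) (e : ∀ x, A x ≃ₗ[ℝ] B x)
    (he : Continuous fun p : FamTotal A => (⟨p.proj, e p.proj p.snd⟩ : FamTotal B))
    (he' : Continuous fun p : FamTotal B => (⟨p.proj, (e p.proj).symm p.snd⟩ : FamTotal A)) :
    IsVectorBundle A := by
  refine ⟨hB.1.comp he, fun x₀ => ?_⟩
  obtain ⟨U, hU, hx, n, φ, hφ, hφ'⟩ := hB.2 x₀
  refine ⟨U, hU, hx, n, fun x => (e x).trans (φ x), ?_, he'.comp hφ'⟩
  exact hφ.comp (Continuous.subtype_mk (he.comp continuous_subtype_val) fun p => p.2)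

namespace IsSubbundle

variable {X : Type} [NormedAddCommGroup X] [NormedSpace ℝ X] {S : Λ → Submodule ℝ X}

theorem continuous_coe (hS : IsSubbundle S) :
    Continuous fun p : hS.toBundle.Total => ((show S p.proj from p.snd : S p.proj) : X) :=
  letI := subTopology S
  (continuous_induced_dom (f := fun p : FamTotal (fun x => S x) => (p.proj, (p.snd : X)))).snd

theorem continuous_mk (hS : IsSubbundle S) {Z : Type*} [TopologicalSpace Z]
    {b : Z → Λ} {f : ∀ z, S (b z)} (hb : Continuous b) (hf : Continuous fun z => (f z : X)) :
    Continuous fun z => (⟨b z, f z⟩ : hS.toBundle.Total) :=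
  letI := subTopology S
  (continuous_induced_rng (f := fun p : FamTotal (fun x => S x) => (p.proj, (p.snd : X)))).2
    (hb.prodMk hf)

/-- If `P x` is a projection onto `S x`, then `P x₀ P x + (1 - P x₀) (1 - P x)` carries `S x` to
`S x₀`; it is invertible for `x` near `x₀` because it is the identity at `x₀`. -/
theorem of_projection [FiniteDimensional ℝ X] {P : Λ → X →L[ℝ] X} (hP : Continuous P)
    (hmem : ∀ x v, P x v ∈ S x) (hfix : ∀ x, ∀ v ∈ S x, P x v = v) : IsSubbundle S := by
  have := FiniteDimensional.complete ℝ X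
  let _ := subTopology S
  have hd : Continuous (fun p : FamTotal (fun x => S x) => (p.proj, (p.snd : X))) :=
    continuous_induced_dom
  refine ⟨hd.fst, fun x₀ => ?_⟩
  have hPP x : P x * P x = P x := by
    ext1 v
    exact hfix x _ (hmem x v)
  let U x : X →L[ℝ] X := P x₀ * P x + (1 - P x₀) * (1 - P x)
  have hU : Continuous U := by fun_prop
  have hU₀ : U x₀ = 1 := by
    simp only [U, mul_sub, sub_mul, hPP]
    simp
  have hcomm x : P x₀ * U x = U x * P x := by
    simp only [U, mul_add, add_mul, mul_sub, sub_mul, one_mul, mul_one, ← mul_assoc, hPP]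
    simp only [mul_assoc, hPP]
    abel
  let O : Set Λ := {x | IsUnit (U x)}
  have hUS x (v : S x) : U x v ∈ S x₀ := by
    have h := congrArg (fun T : X →L[ℝ] X => T v) (hcomm x)
    simp only [mul_apply_eq_comp, hfix x _ v.2] at h
    exact h ▸ hmem x₀ _
  have hinv (x : O) (v : S x₀) : Ring.inverse (U x) v ∈ S x := by
    have h : P x * Ring.inverse (U x) = Ring.inverse (U x) * P x₀ := by
      rw [← one_mul (P x), ← Ring.inverse_mul_cancel _ x.2, mul_assoc _ _ (P x), ← hcomm,
        mul_assoc, mul_assoc, Ring.mul_inverse_cancel _ x.2, mul_one]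
    have h := congrArg (fun T : X →L[ℝ] X => T v) h
    simp only [mul_apply_eq_comp, hfix x₀ _ v.2] at h
    exact h ▸ hmem x _
  let ψ (x : O) : S x ≃ₗ[ℝ] S x₀ :=
    { toFun v := ⟨U x v, hUS x v⟩
      map_add' v w := Subtype.ext (map_add (U x) _ _)
      map_smul' c v := Subtype.ext (map_smul (U x) _ _)
      invFun v := ⟨Ring.inverse (U x) v, hinv x v⟩
      left_inv v := Subtype.ext
        (congrArg (fun T : X →L[ℝ] X => T v) (Ring.inverse_mul_cancel _ x.2))
      right_inv v := Subtype.ext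
        (congrArg (fun T : X →L[ℝ] X => T v) (Ring.mul_inverse_cancel _ x.2)) }
  let e : S x₀ ≃L[ℝ] EuclideanSpace ℝ (Fin (Module.finrank ℝ (S x₀))) :=
    ContinuousLinearEquiv.ofFinrankEq (by simp)
  refine ⟨O, Units.isOpen.preimage hU, ?_, Module.finrank ℝ (S x₀),
    fun x => (ψ x).trans e.toLinearEquiv, ?_, ?_⟩
  · simp only [O, Set.mem_ofPred_eq, hU₀, isUnit_one]
  · refine e.continuous.comp (Continuous.subtype_mk ?_ _)
    exact (hU.comp (hd.fst.comp continuous_subtype_val)).clm_apply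
      (hd.snd.comp continuous_subtype_val)
  · refine continuous_induced_rng.2 ((continuous_subtype_val.comp continuous_fst).prodMk ?_)
    have hi : Continuous fun x : O => Ring.inverse (U x) :=
      (hU.comp continuous_subtype_val).ringInverse fun x => x.2
    exact (hi.comp continuous_fst).clm_apply
      (continuous_subtype_val.comp (e.symm.continuous.comp continuous_snd))

end IsSubbundle

/-- The orthogonal projections onto the fibres of a subbundle depend continuously on the base
point: in a local frame `B` the projection is `B (B†B)⁻¹ B†`. -/
theorem IsSubbundle.continuous_starProjection {X : Type} [NormedAddCommGroup X]
    [InnerProductSpace ℝ X] [FiniteDimensional ℝ X] {S : Λ → Submodule ℝ X}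
    (hS : IsSubbundle S) : Continuous fun x => (S x).starProjection := by
  have := FiniteDimensional.complete ℝ X
  refine continuous_iff_continuousAt.2 fun x₀ => ?_
  obtain ⟨U, hU, hx, n, φ, -, hφ⟩ := hS.toBundle.isVectorBundle.2 x₀
  let B (x : U) : EuclideanSpace ℝ (Fin n) →L[ℝ] X :=
    LinearMap.toContinuousLinearMap ((S x).subtype ∘ₗ (φ x).symm.toLinearMap)
  have hB : Continuous B := continuous_clm_apply.2 fun v =>
    hS.continuous_coe.comp (hφ.comp (Continuous.prodMk_left v))
  have hBa : Continuous fun x => (B x).adjoint :=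
    ContinuousLinearMap.adjoint.continuous.comp hB
  have hinj x : Function.Injective (B x) := Subtype.val_injective.comp (φ x).symm.injective
  have hu x : IsUnit ((B x).adjoint ∘L B x) := by
    rw [ContinuousLinearMap.isUnit_iff_isUnit_toLinearMap, LinearMap.isUnit_iff_ker_eq_bot,
      ContinuousLinearMap.ker_adjoint_comp_self]
    exact LinearMap.ker_eq_bot.2 (hinj x)
  have key (x : U) : (S x).starProjection =
      B x ∘L Ring.inverse ((B x).adjoint ∘L B x) ∘L (B x).adjoint := by
    ext1 v
    refine Submodule.eq_starProjection_of_mem_of_inner_eq_zero ((φ x).symm _).2 fun w hw => ?_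
    obtain ⟨u, rfl⟩ : ∃ u, B x u = w := ⟨φ x ⟨w, hw⟩,
      congrArg (Subtype.val (p := fun v => v ∈ S x)) ((φ x).symm_apply_apply ⟨w, hw⟩)⟩
    rw [← ContinuousLinearMap.adjoint_inner_left, map_sub]
    have h := congrArg (fun T : _ →L[ℝ] EuclideanSpace ℝ (Fin n) => T ((B x).adjoint v))
      (Ring.mul_inverse_cancel _ (hu x))
    have h' : (B x).adjoint ((B x ∘L Ring.inverse ((B x).adjoint ∘L B x) ∘L (B x).adjoint) v)
      = (B x).adjoint v := h
    rw [h', sub_self, inner_zero_left]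
  have hc : Continuous fun x : U => (S x).starProjection := by
    simp only [key]
    exact hB.clm_comp (((hBa.clm_comp hB).ringInverse hu).clm_comp hBa)
  exact (hU.isOpenEmbedding_subtypeVal.continuousAt_iff (x := ⟨x₀, hx⟩)).1 hc.continuousAt

theorem IsSubbundle.orthogonal {X : Type} [NormedAddCommGroup X]
    [InnerProductSpace ℝ X] [FiniteDimensional ℝ X] {S : Λ → Submodule ℝ X}
    (hS : IsSubbundle S) : IsSubbundle fun x => (S x)ᗮ := by
  refine .of_projection (P := fun x => 1 - (S x).starProjection)
    (continuous_const.sub hS.continuous_starProjection) (fun x v => ?_) fun x v hv => ?_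
  · exact (S x).sub_starProjection_mem_orthogonal v
  · simp [(Submodule.starProjection_apply_eq_zero_iff _).2 hv]

/-! ### Classes in `KO` -/

namespace RealVectorBundle

theorem toKO_sum (E F : RealVectorBundle Λ) : (E.sum F).toKO = E.toKO + F.toKO :=
  (Algebra.GrothendieckAddGroup.of (M := StableClass Λ)).map_add
    (Quotient.mk (stableSetoid Λ) E) (Quotient.mk (stableSetoid Λ) F)

theorem Iso.toKO_eq {E F : RealVectorBundle Λ} (i : Iso E F) : E.toKO = F.toKO :=
  congrArg (fun c : StableClass Λ => (Algebra.GrothendieckAddGroup.of c : KO Λ))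
    (Quotient.sound i.stablyIso)

end RealVectorBundle

open RealVectorBundle

/-- A family of subspaces that is fibrewise isomorphic to a subbundle, by isomorphisms that are
continuous in both directions, is a subbundle of the same class. -/
theorem IsSubbundle.exists_toKO_eq_of_equiv {X Y : Type} [NormedAddCommGroup X] [NormedSpace ℝ X]
    [NormedAddCommGroup Y] [NormedSpace ℝ Y] {S : Λ → Submodule ℝ X} {T : Λ → Submodule ℝ Y}
    (hT : IsSubbundle T) (e : ∀ x, S x ≃ₗ[ℝ] T x)
    (he : Continuous[subTopology S, _] fun p : FamTotal (fun x => S x) => (e p.proj p.snd : Y))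
    (he' : Continuous[subTopology T, _]
      fun p : FamTotal (fun x => T x) => ((e p.proj).symm p.snd : X)) :
    ∃ hS : IsSubbundle S, hS.toBundle.toKO = hT.toBundle.toKO := by
  let _ := subTopology S
  have hd : Continuous (fun p : FamTotal (fun x => S x) => (p.proj, (p.snd : X))) :=
    continuous_induced_dom
  have h : Continuous fun p : FamTotal (fun x => S x) =>
      (⟨p.proj, e p.proj p.snd⟩ : hT.toBundle.Total) := hT.continuous_mk hd.fst he
  have h' : Continuous fun p : hT.toBundle.Total =>
      (⟨p.proj, (e p.proj).symm p.snd⟩ : FamTotal (fun x => S x)) :=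
    continuous_induced_rng.2 (hT.toBundle.isVectorBundle.1.prodMk he')
  have hS : IsSubbundle S := IsVectorBundle.of_equiv hT.toBundle.isVectorBundle e h h'
  exact ⟨hS, Iso.toKO_eq (E := hS.toBundle) (F := hT.toBundle) ⟨e, h, h'⟩⟩

/-- `S ⊕ S^⊥` is trivial. -/
theorem IsSubbundle.toKO_add_orthogonal {X : Type} [NormedAddCommGroup X]
    [InnerProductSpace ℝ X] [FiniteDimensional ℝ X] {S : Λ → Submodule ℝ X}
    (hS : IsSubbundle S) :
    hS.toBundle.toKO + hS.orthogonal.toBundle.toKO = (trivialBundle Λ X).toKO := by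
  rw [← toKO_sum]
  have hc := hS.continuous_starProjection
  let e (x : Λ) : (S x × ↥(S x)ᗮ) ≃ₗ[ℝ] X :=
    { toFun := fun u => u.1 + u.2
      map_add' := fun u v => by simp only [Prod.fst_add, Prod.snd_add, Submodule.coe_add]; abel
      map_smul' := fun r u => by simp
      invFun := fun v => (⟨(S x).starProjection v, Submodule.starProjection_apply_mem _ _⟩,
        ⟨v - (S x).starProjection v, (S x).sub_starProjection_mem_orthogonal v⟩)
      left_inv := fun u => by
        have h₁ := Submodule.starProjection_eq_self_iff.2 u.1.2
        have h₂ := (Submodule.starProjection_apply_eq_zero_iff _).2 u.2.2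
        ext <;> simp only [map_add, h₁, h₂] <;> abel
      right_inv := fun v => add_sub_cancel _ _ }
  refine Iso.toKO_eq (E := hS.toBundle.sum hS.orthogonal.toBundle) (F := trivialBundle Λ X)
    { equiv := e
      continuous_toFun := ?_
      continuous_invFun := ?_ }
  · exact continuous_trivial_mk (RealVectorBundle.sum _ _).isVectorBundle.1
      ((hS.continuous_coe.comp (continuous_sum_fst _ _)).add
        (hS.orthogonal.continuous_coe.comp (continuous_sum_snd _ _)))
  · have hp := (trivialBundle Λ X).isVectorBundle.1
    have h := (hc.comp hp).clm_apply (continuous_trivial_snd X)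
    exact continuous_sum_mk (E := hS.toBundle) (F := hS.orthogonal.toBundle)
      (hS.continuous_mk (f := fun p : (trivialBundle Λ X).Total => ((e p.proj).symm p.snd).1) hp h)
      (hS.orthogonal.continuous_mk
        (f := fun p : (trivialBundle Λ X).Total => ((e p.proj).symm p.snd).2) hp
        ((continuous_trivial_snd X).sub h))

/-! ### The bundle of matching data -/

section Matching

variable {V H : Type} [NormedAddCommGroup V] [NormedSpace ℝ V] [FiniteDimensional ℝ V]
  [NormedAddCommGroup H] [InnerProductSpace ℝ H] [FiniteDimensional ℝ H]

/-- The triples `(v, p, q)` with `p ∈ E`, `q ∈ F^⊥` and `p - q = c v`. -/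
def matchingSpace (E F : Submodule ℝ H) (c : V →L[ℝ] H) : Submodule ℝ (V × H × H) where
  carrier := {y | y.2.1 ∈ E ∧ y.2.2 ∈ Fᗮ ∧ y.2.1 - y.2.2 = c y.1}
  add_mem' := fun {a b} ha hb => ⟨add_mem ha.1 hb.1, add_mem ha.2.1 hb.2.1, by
    simp only [Prod.snd_add, Prod.fst_add, map_add, ← ha.2.2, ← hb.2.2]
    abel⟩
  zero_mem' := by simp
  smul_mem' := fun r a ha => ⟨E.smul_mem r ha.1, Fᗮ.smul_mem r ha.2.1, by
    simp only [Prod.smul_snd, Prod.smul_fst, map_smul, ← ha.2.2, smul_sub]⟩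

/-- If every vector of `H` has the form `p - q - c v` with `p ∈ E` and `q ∈ F^⊥`, then the triples
with `p - q = c v` form a vector bundle of class `[E] + [Θ(V)] - [F]`: with `P`, `Q` the projections
onto `E`, `F` and `R` a right inverse of `D (v, w, z) = P w - (1 - Q) z - c v` with values in
`V × E × F^⊥`, the bundle is the image of the projection `(1, P, 1 - Q) (1 - R D)`, and
`V × H × H` is the direct sum of this image, of `0 × E^⊥ × F` and of the image of `R`. -/
theorem isSubbundle_matchingSpace {E F : Λ → Submodule ℝ H} (hE : IsSubbundle E)
    (hF : IsSubbundle F) {c : Λ → V →L[ℝ] H} (hc : Continuous c)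
    (hs : ∀ x h, ∃ v, ∃ p ∈ E x, ∃ q ∈ (F x)ᗮ, p - q - c x v = h) :
    ∃ hT : IsSubbundle fun x => matchingSpace (E x) (F x) (c x),
      hT.toBundle.toKO + hF.toBundle.toKO = hE.toBundle.toKO + (trivialBundle Λ V).toKO := by
  let P x := (E x).starProjection
  let Q x := (F x).starProjection
  have hP : Continuous P := hE.continuous_starProjection
  have hQ : Continuous Q := hF.continuous_starProjection
  have hPm x v : P x v ∈ E x := Submodule.starProjection_apply_mem _ _
  have hQm x v : Q x v ∈ F x := Submodule.starProjection_apply_mem _ _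
  have hPm' x v : v - P x v ∈ (E x)ᗮ := (E x).sub_starProjection_mem_orthogonal v
  have hQm' x v : v - Q x v ∈ (F x)ᗮ := (F x).sub_starProjection_mem_orthogonal v
  have hPf x {v} (hv : v ∈ E x) : P x v = v := Submodule.starProjection_eq_self_iff.2 hv
  have hQf x {v} (hv : v ∈ F x) : Q x v = v := Submodule.starProjection_eq_self_iff.2 hv
  have hP0 x {v} (hv : v ∈ (E x)ᗮ) : P x v = 0 :=
    (Submodule.starProjection_apply_eq_zero_iff _).2 hv
  have hQ0 x {v} (hv : v ∈ (F x)ᗮ) : Q x v = 0 :=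
    (Submodule.starProjection_apply_eq_zero_iff _).2 hv
  let π₁ : V × H × H →L[ℝ] H := .fst ℝ H H ∘L .snd ℝ V (H × H)
  let π₂ : V × H × H →L[ℝ] H := .snd ℝ H H ∘L .snd ℝ V (H × H)
  let D x : V × H × H →L[ℝ] H :=
    P x ∘L π₁ - (π₂ - Q x ∘L π₂) - c x ∘L .fst ℝ V (H × H)
  have hDa x y : D x y = P x y.2.1 - (y.2.2 - Q x y.2.2) - c x y.1 := rfl
  have hD : Continuous D := continuous_clm_apply.2 fun y => by
    simp only [hDa]
    fun_prop
  obtain ⟨R₀, hR₀, hDR₀⟩ := exists_continuous_rightInverse hD fun x h => by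
    obtain ⟨v, p, hp, q, hq, rfl⟩ := hs x h
    exact ⟨(v, p, q), by simp [hDa, hPf x hp, hQ0 x hq]⟩
  -- `pr x` is the projection onto `V × E × F^⊥`; it preserves the kernel of `D x`.
  let pr x : V × H × H →L[ℝ] V × H × H :=
    (ContinuousLinearMap.fst ℝ V (H × H)).prod ((P x ∘L π₁).prod (π₂ - Q x ∘L π₂))
  have hpra x y : pr x y = (y.1, P x y.2.1, y.2.2 - Q x y.2.2) := rfl
  have hprc : Continuous pr := continuous_clm_apply.2 fun y => by
    simp only [hpra]
    fun_prop
  have hprpr x y : pr x (pr x y) = pr x y := by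
    simp only [hpra, hPf x (hPm x _), hQ0 x (hQm' x _), sub_zero]
  have hDpr x y : D x (pr x y) = D x y := by
    simp only [hDa, hpra, hPf x (hPm x _), hQ0 x (hQm' x _), sub_zero]
  have hmem x y (hy : D x y = 0) : pr x y ∈ matchingSpace (E x) (F x) (c x) :=
    ⟨hPm x _, hQm' x _, sub_eq_zero.1 ((hDa x y).symm.trans hy)⟩
  have hprT x {y} (hy : y ∈ matchingSpace (E x) (F x) (c x)) : pr x y = y := by
    rw [hpra, hPf x hy.1, hQ0 x hy.2.1, sub_zero]
  have hDT x {y} (hy : y ∈ matchingSpace (E x) (F x) (c x)) : D x y = 0 := by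
    rw [hDa, hPf x hy.1, hQ0 x hy.2.1, sub_zero, hy.2.2, sub_self]
  -- `J x` is the projection `pr (1 - R D)` for the right inverse `R = pr R₀`.
  let J x : V × H × H →L[ℝ] V × H × H := pr x ∘L (1 - R₀ x ∘L D x)
  have hJa x y : J x y = pr x (y - R₀ x (D x y)) := rfl
  have hJ : Continuous J :=
    hprc.clm_comp (continuous_const.sub (hR₀.clm_comp hD))
  have hJm x y : J x y ∈ matchingSpace (E x) (F x) (c x) :=
    hmem x (y - R₀ x (D x y)) (by rw [map_sub, hDR₀, sub_self])
  have hT : IsSubbundle fun x => matchingSpace (E x) (F x) (c x) :=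
    .of_projection hJ hJm fun x y hy => by rw [hJa, hDT x hy, map_zero, sub_zero, hprT x hy]
  refine ⟨hT, ?_⟩
  let T x := matchingSpace (E x) (F x) (c x)
  let e (x : Λ) : ((T x × ↥(E x)ᗮ) × F x × H) ≃ₗ[ℝ] V × H × H :=
    { toFun := fun u => (u.1.1 : V × H × H) + ((0, (u.1.2 : H), (u.2.1 : H)) : V × H × H) +
        pr x (R₀ x u.2.2)
      map_add' := fun u v => by
        simp only [Prod.fst_add, Prod.snd_add, Submodule.coe_add, map_add]
        rw [← add_zero (0 : V), ← Prod.mk_add_mk, ← Prod.mk_add_mk, add_zero]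
        abel
      map_smul' := fun r u => by
        simp only [Prod.smul_fst, Prod.smul_snd, Submodule.coe_smul, map_smul, RingHom.id_apply,
          smul_add, Prod.smul_mk, smul_zero]
      invFun := fun y => ((⟨J x y, hJm x y⟩, ⟨y.2.1 - P x y.2.1, hPm' x _⟩),
        ⟨Q x y.2.2, hQm x _⟩, D x y)
      left_inv := fun u => by
        obtain ⟨⟨⟨t, ht⟩, ⟨a, ha⟩⟩, ⟨b, hb⟩, r⟩ := u
        have h1 : D x (t + (0, a, b) + pr x (R₀ x r)) = r := by
          rw [map_add, map_add, hDT x ht, hDpr, hDR₀, hDa, hP0 x ha, hQf x hb]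
          simp
        have h2 : pr x (0, a, b) = 0 := by
          rw [hpra, hP0 x ha, hQf x hb, sub_self]
          rfl
        have h3 : J x (t + (0, a, b) + pr x (R₀ x r)) = t := by
          rw [hJa, h1, map_sub, map_add, map_add, hprT x ht, h2, hprpr, add_zero,
            add_sub_cancel_right]
        refine Prod.ext (Prod.ext (Subtype.ext h3) (Subtype.ext ?_))
          (Prod.ext (Subtype.ext ?_) h1)
        · have h4 := hPf x ht.1
          have h5 := hPf x (hPm x (R₀ x r).2.1)
          simp only [hpra, Prod.snd_add, Prod.fst_add, map_add, h4, h5, hP0 x ha]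
          abel
        · have h4 := hQ0 x ht.2.1
          have h5 := hQ0 x (hQm' x (R₀ x r).2.2)
          simp only [hpra, Prod.snd_add, map_add, h4, h5, hQf x hb]
          abel
      right_inv := fun y => by
        have h1 : y = pr x y + (0, y.2.1 - P x y.2.1, Q x y.2.2) := by
          ext <;> simp [hpra]
        have h2 : J x y = pr x y - pr x (R₀ x (D x y)) :=
          (hJa x y).trans (map_sub _ _ _)
        conv_rhs => rw [h1]
        simp only [h2]
        abel }
  have hiso : Iso ((hT.toBundle.sum hE.orthogonal.toBundle).sum
      (hF.toBundle.sum (trivialBundle Λ H)))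
      ((trivialBundle Λ V).sum ((trivialBundle Λ H).sum (trivialBundle Λ H))) :=
    { equiv := e
      continuous_toFun := by
        have hb := ((hT.toBundle.sum hE.orthogonal.toBundle).sum
          (hF.toBundle.sum (trivialBundle Λ H))).isVectorBundle.1
        have h₁ := continuous_sum_fst (hT.toBundle.sum hE.orthogonal.toBundle)
          (hF.toBundle.sum (trivialBundle Λ H))
        have h₂ := continuous_sum_snd (hT.toBundle.sum hE.orthogonal.toBundle)
          (hF.toBundle.sum (trivialBundle Λ H))
        have ht := hT.continuous_coe.comp ((continuous_sum_fst _ _).comp h₁)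
        have ha := hE.orthogonal.continuous_coe.comp ((continuous_sum_snd _ _).comp h₁)
        have hf := hF.continuous_coe.comp ((continuous_sum_fst _ _).comp h₂)
        have hr := (continuous_trivial_snd H).comp ((continuous_sum_snd _ _).comp h₂)
        have hy := (ht.add ((continuous_const (y := (0 : V))).prodMk (ha.prodMk hf))).add
          ((hprc.comp hb).clm_apply ((hR₀.comp hb).clm_apply hr))
        exact continuous_sum_mk (E := trivialBundle Λ V)
          (F := (trivialBundle Λ H).sum (trivialBundle Λ H)) (continuous_trivial_mk hb hy.fst)
          (continuous_sum_mk (E := trivialBundle Λ H) (F := trivialBundle Λ H)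
            (continuous_trivial_mk hb hy.snd.fst) (continuous_trivial_mk hb hy.snd.snd))
      continuous_invFun := by
        let B := (trivialBundle Λ V).sum ((trivialBundle Λ H).sum (trivialBundle Λ H))
        have hb := B.isVectorBundle.1
        have h₂ := continuous_sum_snd (trivialBundle Λ V)
          ((trivialBundle Λ H).sum (trivialBundle Λ H))
        have hy₀ := (continuous_trivial_snd V).comp (continuous_sum_fst (trivialBundle Λ V)
          ((trivialBundle Λ H).sum (trivialBundle Λ H)))
        have hy₁ := (continuous_trivial_snd H).comp ((continuous_sum_fst _ _).comp h₂)
        have hy₂ := (continuous_trivial_snd H).comp ((continuous_sum_snd _ _).comp h₂)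
        have hy := hy₀.prodMk (hy₁.prodMk hy₂)
        exact continuous_sum_mk (E := hT.toBundle.sum hE.orthogonal.toBundle)
          (F := hF.toBundle.sum (trivialBundle Λ H))
          (continuous_sum_mk (E := hT.toBundle) (F := hE.orthogonal.toBundle)
            (hT.continuous_mk (f := fun p : B.Total => ((e p.proj).symm p.snd).1.1) hb
              ((hJ.comp hb).clm_apply hy))
            (hE.orthogonal.continuous_mk (f := fun p : B.Total => ((e p.proj).symm p.snd).1.2) hb
              (hy₁.sub ((hP.comp hb).clm_apply hy₁))))
          (continuous_sum_mk (E := hF.toBundle) (F := trivialBundle Λ H)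
            (hF.continuous_mk (f := fun p : B.Total => ((e p.proj).symm p.snd).2.1) hb
              ((hQ.comp hb).clm_apply hy₂))
            (continuous_trivial_mk hb ((hD.comp hb).clm_apply hy))) }
  have h := hiso.toKO_eq
  simp only [toKO_sum, ← hE.toKO_add_orthogonal] at h
  rw [← sub_eq_zero] at h ⊢
  rw [← h]
  abel

end Matching

end Bundles

/-! ### Hyperbolic matrices -/

section Hyperbolic

/-- If `S` and its right inverse `R` are contractions, then `S - 1/2 = S (1 - R/2)` and
`S - 2 = -2 (1 - S/2)` have right inverses, by the Neumann series. -/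
theorem exists_rightInverse_sub {X : Type*} [NormedAddCommGroup X] [NormedSpace ℝ X]
    [CompleteSpace X] {S R : X →L[ℝ] X} (hSR : ∀ v, S (R v) = v) (hS : ‖S‖ ≤ 1) (hR : ‖R‖ ≤ 1) :
    ∃ a b : X →L[ℝ] X, (∀ v, S (a v) = (1 / 2 : ℝ) • a v + v) ∧
      ∀ v, S (b v) = (2 : ℝ) • b v + v := by
  have hu {T : X →L[ℝ] X} (hT : ‖T‖ ≤ 1) : IsUnit (1 - (1 / 2 : ℝ) • T) := by
    refine isUnit_one_sub_of_norm_lt_one ?_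
    rw [norm_smul]
    norm_num
    linarith
  have key {T : X →L[ℝ] X} (hT : ‖T‖ ≤ 1) (v : X) :
      Ring.inverse (1 - (1 / 2 : ℝ) • T) v =
        (1 / 2 : ℝ) • T (Ring.inverse (1 - (1 / 2 : ℝ) • T) v) + v := by
    have h := congrArg (fun A : X →L[ℝ] X => A v) (Ring.mul_inverse_cancel _ (hu hT))
    exact eq_add_of_sub_eq' h
  refine ⟨Ring.inverse (1 - (1 / 2 : ℝ) • R) ∘L R,
    (-1 / 2 : ℝ) • Ring.inverse (1 - (1 / 2 : ℝ) • S), fun v => ?_, fun v => ?_⟩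
  · have h := congrArg S (key hR (R v))
    simpa [hSR] using h
  · have h := key hS v
    set w := Ring.inverse (1 - (1 / 2 : ℝ) • S) v
    have h' : v = w - (1 / 2 : ℝ) • S w := eq_sub_of_add_eq' h.symm
    change S ((-1 / 2 : ℝ) • w) = (2 : ℝ) • (-1 / 2 : ℝ) • w + v
    rw [h', map_smul]
    module

variable {H : Type*} [NormedAddCommGroup H] [NormedSpace ℝ H]

/-- The operator that is `1/2` on the image and `2` on the kernel of the projection `P`. -/
noncomputable def hyperbolic (P : H →L[ℝ] H) : H →L[ℝ] H :=
  (1 / 2 : ℝ) • P + (2 : ℝ) • (1 - P)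

theorem hyperbolic_apply (P : H →L[ℝ] H) (v : H) :
    hyperbolic P v = (1 / 2 : ℝ) • P v + (2 : ℝ) • (v - P v) := rfl

theorem continuous_hyperbolic : Continuous (hyperbolic (H := H)) := by
  unfold hyperbolic
  fun_prop

theorem hyperbolic_compl_hyperbolic {P : H →L[ℝ] H} (hP : ∀ v, P (P v) = P v) (v : H) :
    hyperbolic (1 - P) (hyperbolic P v) = v := by
  have h (w : H) : (1 - P) w = w - P w := rfl
  simp only [hyperbolic_apply, h, map_add, map_sub, map_smul, hP]
  module

theorem isUnit_hyperbolic {P : H →L[ℝ] H} (hP : ∀ v, P (P v) = P v) : IsUnit (hyperbolic P) := by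
  have hP' v : (1 - P) ((1 - P) v) = (1 - P) v := by simp [hP]
  have h := hyperbolic_compl_hyperbolic hP'
  rw [sub_sub_cancel] at h
  exact ⟨⟨hyperbolic P, hyperbolic (1 - P), ContinuousLinearMap.ext h,
    ContinuousLinearMap.ext (hyperbolic_compl_hyperbolic hP)⟩, rfl⟩

/-- A solution of `u (n + 1) = hyperbolic P (u n)` that decays starts in the image of `P`. -/
theorem eq_of_hyperbolic_of_tendsto {P : H →L[ℝ] H} (hP : ∀ v, P (P v) = P v) {u : ℕ → H}
    (hu : ∀ n, u (n + 1) = hyperbolic P (u n)) (h0 : Tendsto u atTop (𝓝 0)) :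
    P (u 0) = u 0 ∧ ∀ n, u n = (1 / 2 : ℝ) ^ n • u 0 := by
  -- The component in the kernel of `P` doubles at every step, so decay forces it to vanish.
  have hgrow m k : u (m + k) - P (u (m + k)) = (2 : ℝ) ^ k • (u m - P (u m)) := by
    induction k with
    | zero => simp
    | succ k ih =>
      rw [pow_succ', mul_smul, ← ih, ← add_assoc, hu]
      simp only [hyperbolic_apply, map_add, map_sub, map_smul, hP]
      module
  have hfix m : P (u m) = u m := by
    have ht : Tendsto (fun k => u (m + k) - P (u (m + k))) atTop (𝓝 0) := by
      have h := h0.comp (tendsto_add_atTop_nat m)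
      simp only [Function.comp_def, add_comm _ m] at h
      simpa using h.sub ((P.continuous.tendsto 0).comp h)
    have hle k : ‖u m - P (u m)‖ ≤ ‖u (m + k) - P (u (m + k))‖ := by
      rw [hgrow, norm_smul, norm_pow]
      exact le_mul_of_one_le_left (norm_nonneg _) (one_le_pow₀ (by norm_num))
    have h := ge_of_tendsto' ht.norm hle
    rw [norm_zero, norm_le_zero_iff, sub_eq_zero] at h
    exact h.symm
  refine ⟨hfix 0, fun n => ?_⟩
  induction n with
  | zero => simp
  | succ n ih =>
    rw [hu, pow_succ', mul_smul, ← ih, hyperbolic_apply, hfix]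
    simp

end Hyperbolic

/-! ### Operators on `ℓ₀(ℝᵈ)` -/

namespace EllZero

variable {d : ℕ}

theorem norm_apply_le (φ : EllZero d) (n : ℤ) : ‖φ n‖ ≤ ‖φ‖ := by
  rw [← ZeroAtInftyContinuousMap.norm_toBCF_eq_norm]
  exact φ.toBCF.norm_coe_le_norm n

theorem norm_le {φ : EllZero d} {C : ℝ} (hC : 0 ≤ C) (h : ∀ n, ‖φ n‖ ≤ C) : ‖φ‖ ≤ C := by
  rw [← ZeroAtInftyContinuousMap.norm_toBCF_eq_norm]
  exact (BoundedContinuousFunction.norm_le hC).2 h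

/-- Evaluation at an integer. -/
noncomputable def eval (n : ℤ) : EllZero d →L[ℝ] Rd d :=
  LinearMap.mkContinuous
    { toFun := fun φ => φ n
      map_add' := fun _ _ => rfl
      map_smul' := fun _ _ => rfl } 1 fun φ => by
    rw [one_mul]
    exact norm_apply_le φ n

@[simp] theorem eval_apply (n : ℤ) (φ : EllZero d) : eval n φ = φ n := rfl

/-- The right shift, inverse to `leftShift`. -/
noncomputable def rightShift (d : ℕ) : EllZero d →L[ℝ] EllZero d :=
  LinearMap.mkContinuous
    { toFun := fun φ =>
        { toFun := fun n => φ (n - 1)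
          continuous_toFun := continuous_of_discreteTopology
          zero_at_infty' := φ.zero_at_infty'.comp
            (Homeomorph.subRight (1 : ℤ)).isClosedEmbedding.tendsto_cocompact }
      map_add' := fun _ _ => rfl
      map_smul' := fun _ _ => rfl }
    1 fun φ => by
      rw [one_mul]
      exact norm_le (norm_nonneg _) fun n => norm_apply_le φ (n - 1)

@[simp] theorem rightShift_apply (φ : EllZero d) (n : ℤ) : rightShift d φ n = φ (n - 1) := rfl

/-- The operator that applies a fixed matrix to every term. -/
noncomputable def pointwise (a : Rd d →L[ℝ] Rd d) : EllZero d →L[ℝ] EllZero d :=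
  nemitski (fun _ => a) ⟨‖a‖, fun _ => le_rfl⟩

@[simp] theorem pointwise_apply (a : Rd d →L[ℝ] Rd d) (φ : EllZero d) (n : ℤ) :
    pointwise a φ n = a (φ n) := rfl

theorem continuous_pointwise : Continuous (pointwise (d := d)) := by
  suffices h : LipschitzWith 1 (pointwise (d := d)) from h.continuous
  refine LipschitzWith.of_dist_le_mul fun a b => ?_
  rw [NNReal.coe_one, one_mul, dist_eq_norm, dist_eq_norm]
  refine ContinuousLinearMap.opNorm_le_bound _ (norm_nonneg _) fun φ =>
    norm_le (mul_nonneg (norm_nonneg _) (norm_nonneg _)) fun n => ?_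
  exact ((a - b).le_opNorm (φ n)).trans
    (mul_le_mul_of_nonneg_left (norm_apply_le φ n) (norm_nonneg _))

/-- The operator that replaces the terms with index outside `s` by zero. -/
noncomputable def cutoff (s : ℤ → Prop) [DecidablePred s] : EllZero d →L[ℝ] EllZero d :=
  nemitski (fun n => if s n then 1 else 0) ⟨‖(1 : Rd d →L[ℝ] Rd d)‖, fun n => by
    split_ifs <;> simp⟩

@[simp] theorem cutoff_apply (s : ℤ → Prop) [DecidablePred s] (φ : EllZero d) (n : ℤ) :
    cutoff s φ n = if s n then φ n else 0 := by
  simp only [cutoff, nemitski_apply]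
  split_ifs <;> rfl

/-- The sequences `n ↦ 2^{-|n|} v`. -/
noncomputable def peak (d : ℕ) : Rd d →L[ℝ] EllZero d :=
  LinearMap.mkContinuous
    { toFun := fun v =>
        { toFun := fun n => (1 / 2 : ℝ) ^ n.natAbs • v
          continuous_toFun := continuous_of_discreteTopology
          zero_at_infty' := by
            have h : Tendsto Int.natAbs (cocompact ℤ) atTop := by
              rw [cocompact_eq_cofinite, ← Nat.cofinite_eq_atTop]
              refine Tendsto.cofinite_of_finite_preimage_singleton fun n => ?_
              refine (Set.finite_Icc (-n : ℤ) n).subset fun m hm => ?_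
              simp only [Set.mem_preimage, Set.mem_singleton_iff] at hm
              simp only [Set.mem_Icc]
              omega
            simpa using ((tendsto_pow_atTop_nhds_zero_of_lt_one (r := (1 / 2 : ℝ)) (by norm_num)
              (by norm_num)).comp h).smul_const v }
      map_add' := fun v w => by ext1 n; exact smul_add _ v w
      map_smul' := fun c v => by ext1 n; exact smul_comm _ c v }
    1 fun v => by
      rw [one_mul]
      refine norm_le (norm_nonneg _) fun n => ?_
      have h : ‖(1 / 2 : ℝ) ^ n.natAbs‖ ≤ 1 := by
        rw [norm_pow]
        exact pow_le_one₀ (norm_nonneg _) (by norm_num)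
      exact (norm_smul_le _ _).trans (mul_le_of_le_one_left (norm_nonneg v) h)

@[simp] theorem peak_apply (v : Rd d) (n : ℤ) : peak d v n = (1 / 2 : ℝ) ^ n.natAbs • v := rfl

end EllZero

open EllZero

/-! ### Green operators -/

section Green

variable {d : ℕ}

theorem exists_scalar_green (d : ℕ) : ∃ a b : EllZero d →L[ℝ] EllZero d,
    (∀ φ, leftShift d (a φ) = (1 / 2 : ℝ) • a φ + φ) ∧
      ∀ φ, leftShift d (b φ) = (2 : ℝ) • b φ + φ :=
  exists_rightInverse_sub (R := rightShift d)
    (fun φ => by ext1 n; exact congrArg φ (add_sub_cancel_right n 1))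
    (LinearMap.mkContinuous_norm_le _ zero_le_one _)
    (LinearMap.mkContinuous_norm_le _ zero_le_one _)

/-- The Green operator of the equation `φ (n + 1) = hyperbolic P (φ n) + ψ n` on the whole of `ℤ`:
a right inverse of `S - 1/2` on the image of `P`, and a right inverse of `S - 2` on the kernel. -/
noncomputable def green (P : Rd d →L[ℝ] Rd d) : EllZero d →L[ℝ] EllZero d :=
  pointwise P ∘L (exists_scalar_green d).choose +
    pointwise (1 - P) ∘L (exists_scalar_green d).choose_spec.choose

theorem continuous_green : Continuous (green (d := d)) :=
  (continuous_pointwise.clm_comp continuous_const).add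
    ((continuous_pointwise.comp (continuous_const.sub continuous_id)).clm_comp
      continuous_const)

theorem green_succ {P : Rd d →L[ℝ] Rd d} (hP : ∀ v, P (P v) = P v) (ψ : EllZero d) (n : ℤ) :
    green P ψ (n + 1) = hyperbolic P (green P ψ n) + ψ n := by
  obtain ⟨ha, hb⟩ := (exists_scalar_green d).choose_spec.choose_spec
  have hg m : green P ψ m = P ((exists_scalar_green d).choose ψ m) +
    ((exists_scalar_green d).choose_spec.choose ψ m -
      P ((exists_scalar_green d).choose_spec.choose ψ m)) := rfl
  replace ha : (exists_scalar_green d).choose ψ (n + 1) =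
      (1 / 2 : ℝ) • (exists_scalar_green d).choose ψ n + ψ n := DFunLike.congr_fun (ha ψ) n
  replace hb : (exists_scalar_green d).choose_spec.choose ψ (n + 1) =
      (2 : ℝ) • (exists_scalar_green d).choose_spec.choose ψ n + ψ n :=
    DFunLike.congr_fun (hb ψ) n
  simp only [hg, ha, hb, hyperbolic_apply, map_add, map_sub, map_smul, hP]
  module

theorem forward_solution {P : Rd d →L[ℝ] Rd d} (hP : ∀ v, P (P v) = P v) {φ : EllZero d}
    (hφ : ∀ n : ℤ, 0 ≤ n → φ (n + 1) = hyperbolic P (φ n)) :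
    P (φ 0) = φ 0 ∧ ∀ n : ℤ, 0 ≤ n → φ n = peak d (φ 0) n := by
  have ht : Tendsto (fun n : ℕ => (n : ℤ)) atTop (cocompact ℤ) := by
    rw [cocompact_eq_cofinite, ← Nat.cofinite_eq_atTop]
    exact Nat.cast_injective.tendsto_cofinite
  have h := eq_of_hyperbolic_of_tendsto hP (u := fun n : ℕ => φ n)
    (fun n => by simpa using hφ n (by positivity)) (φ.zero_at_infty'.comp ht)
  refine ⟨h.1, fun n hn => ?_⟩
  lift n to ℕ using hn
  simpa using h.2 n

/-- A solution that decays in backward time starts in the kernel of the projection: reversed time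
interchanges the image and the kernel. -/
theorem backward_solution {Q : Rd d →L[ℝ] Rd d} (hQ : ∀ v, Q (Q v) = Q v) {φ : EllZero d}
    (hφ : ∀ n : ℤ, n < 0 → φ (n + 1) = hyperbolic Q (φ n)) :
    Q (φ 0) = 0 ∧ ∀ n : ℤ, n ≤ 0 → φ n = peak d (φ 0) n := by
  have ht : Tendsto (fun n : ℕ => -(n : ℤ)) atTop (cocompact ℤ) := by
    rw [cocompact_eq_cofinite, ← Nat.cofinite_eq_atTop]
    exact (neg_injective.comp Nat.cast_injective).tendsto_cofinite
  have hQ' v : (1 - Q) ((1 - Q) v) = (1 - Q) v := by simp [hQ]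
  have h := eq_of_hyperbolic_of_tendsto hQ' (u := fun n : ℕ => φ (-n)) (fun n => by
      have h := hφ (-(n + 1 : ℕ)) (by omega)
      rw [show -((n + 1 : ℕ) : ℤ) + 1 = -n by omega] at h
      simp only [h]
      exact (hyperbolic_compl_hyperbolic hQ _).symm) (φ.zero_at_infty'.comp ht)
  refine ⟨by simpa using h.1, fun n hn => ?_⟩
  obtain ⟨m, rfl⟩ : ∃ m : ℕ, n = -m := ⟨n.natAbs, by omega⟩
  simpa using h.2 m

end Green

/-! ### The equation with hyperbolic coefficients that switch at the origin -/

section Switch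

variable {d : ℕ} {P Q : Rd d →L[ℝ] Rd d}

/-- The coefficients `hyperbolic P` in forward time and `hyperbolic Q` in backward time. -/
noncomputable def switch (P Q : Rd d →L[ℝ] Rd d) (n : ℤ) : Rd d →L[ℝ] Rd d :=
  if 0 ≤ n then hyperbolic P else hyperbolic Q

theorem switch_of_nonneg {n : ℤ} (hn : 0 ≤ n) : switch P Q n = hyperbolic P := if_pos hn

theorem switch_of_neg {n : ℤ} (hn : n < 0) : switch P Q n = hyperbolic Q := if_neg hn.not_ge

theorem exists_norm_switch_le (P Q : Rd d →L[ℝ] Rd d) : ∃ C, ∀ n, ‖switch P Q n‖ ≤ C := by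
  refine ⟨max ‖hyperbolic P‖ ‖hyperbolic Q‖, fun n => ?_⟩
  unfold switch
  split_ifs
  exacts [le_max_left _ _, le_max_right _ _]

/-- The operator `(L φ) n = φ (n + 1) - switch P Q n (φ n)`. -/
noncomputable def switchOp (P Q : Rd d →L[ℝ] Rd d) : EllZero d →L[ℝ] EllZero d :=
  leftShift d - nemitski (switch P Q) (exists_norm_switch_le P Q)

theorem switchOp_apply (φ : EllZero d) (n : ℤ) :
    switchOp P Q φ n = φ (n + 1) - switch P Q n (φ n) := rfl

theorem switchOp_apply_eq_iff {φ ψ : EllZero d} {n : ℤ} :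
    switchOp P Q φ n = ψ n ↔ φ (n + 1) = switch P Q n (φ n) + ψ n := by
  rw [switchOp_apply, sub_eq_iff_eq_add']

theorem switchOp_eq : switchOp P Q = leftShift d -
    (cutoff (0 ≤ ·) ∘L pointwise (hyperbolic P) +
      cutoff (· < 0) ∘L pointwise (hyperbolic Q)) := by
  ext φ n : 2
  rcases le_or_gt 0 n with hn | hn
  · simp [switchOp_apply, switch_of_nonneg hn, hn, hn.not_gt]
  · simp [switchOp_apply, switch_of_neg hn, hn, hn.not_ge]

/-- The sequence that is `green P ψ` plus the homogeneous solution `2⁻ⁿ p` for `n ≥ 0`, and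
`green Q ψ` plus the homogeneous solution `2ⁿ q` for `n < 0`. The two halves fit together at the
origin when `p - q = jump P Q ψ`. -/
noncomputable def glue (P Q : Rd d →L[ℝ] Rd d) (ψ : EllZero d) (p q : Rd d) : EllZero d :=
  cutoff (0 ≤ ·) (green P ψ + peak d p) + cutoff (· < 0) (green Q ψ + peak d q)

theorem glue_of_nonneg {ψ : EllZero d} {p q : Rd d} {n : ℤ} (hn : 0 ≤ n) :
    glue P Q ψ p q n = green P ψ n + peak d p n := by
  simp [glue, hn, hn.not_gt]

theorem glue_of_neg {ψ : EllZero d} {p q : Rd d} {n : ℤ} (hn : n < 0) :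
    glue P Q ψ p q n = green Q ψ n + peak d q n := by
  simp [glue, hn, hn.not_ge]

/-- The difference at the origin between the backward and the forward Green solution. -/
noncomputable def jump (P Q : Rd d →L[ℝ] Rd d) : EllZero d →L[ℝ] Rd d :=
  eval 0 ∘L (green Q - green P)

theorem jump_apply (ψ : EllZero d) : jump P Q ψ = green Q ψ 0 - green P ψ 0 := rfl

/-- Gluing solves the equation with right-hand side `ψ` everywhere except possibly at `-1`, and
there too if the two halves fit together. -/
theorem switchOp_glue_apply (hP : ∀ v, P (P v) = P v) (hQ : ∀ v, Q (Q v) = Q v) (ψ : EllZero d)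
    {p q : Rd d} (hp : P p = p) (hq : Q q = 0) {n : ℤ} (hn : n ≠ -1 ∨ p - q = jump P Q ψ) :
    switchOp P Q (glue P Q ψ p q) n = ψ n := by
  rw [switchOp_apply_eq_iff]
  rcases le_or_gt 0 n with h | h
  · rw [glue_of_nonneg h, glue_of_nonneg (by omega), switch_of_nonneg h, green_succ hP,
      map_add (hyperbolic P)]
    have h2 : (n + 1).natAbs = n.natAbs + 1 := by omega
    have h3 : hyperbolic P (peak d p n) = peak d p (n + 1) := by
      simp only [peak_apply, hyperbolic_apply, map_smul, hp, h2, pow_succ]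
      module
    rw [h3]
    abel
  · -- The backward formula also holds at the origin if the two halves fit together.
    have h1 : glue P Q ψ p q (n + 1) = green Q ψ (n + 1) + peak d q (n + 1) := by
      rcases lt_or_ge (n + 1) 0 with h' | h'
      · exact glue_of_neg h'
      · obtain rfl : n = -1 := by omega
        have h2 : p - q = green Q ψ 0 - green P ψ 0 := hn.resolve_left fun h => h rfl
        rw [glue_of_nonneg h']
        simp only [neg_add_cancel, peak_apply, Int.natAbs_zero, pow_zero, one_smul]
        rw [sub_eq_sub_iff_add_eq_add] at h2
        rw [add_comm, h2]
    have h2 : n.natAbs = (n + 1).natAbs + 1 := by omega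
    have h3 : hyperbolic Q (peak d q n) = peak d q (n + 1) := by
      simp only [peak_apply, hyperbolic_apply, map_smul, hq, h2, pow_succ]
      module
    rw [h1, glue_of_neg h, switch_of_neg h, green_succ hQ,
      map_add (hyperbolic Q), h3]
    abel

/-- Every sequence arises by gluing, from data `p` in the image of `P` and `q` in the kernel of
`Q`. -/
theorem eq_glue (hP : ∀ v, P (P v) = P v) (hQ : ∀ v, Q (Q v) = Q v) (φ : EllZero d) :
    P (φ 0 - green P (switchOp P Q φ) 0) = φ 0 - green P (switchOp P Q φ) 0 ∧
    Q (φ 0 - green Q (switchOp P Q φ) 0) = 0 ∧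
    φ = glue P Q (switchOp P Q φ) (φ 0 - green P (switchOp P Q φ) 0)
      (φ 0 - green Q (switchOp P Q φ) 0) := by
  have hφ n := switchOp_apply_eq_iff.1 (rfl : switchOp P Q φ n = _)
  have h₁ := forward_solution hP (φ := φ - green P (switchOp P Q φ)) fun n hn => by
    simp only [ZeroAtInftyContinuousMap.sub_apply, map_sub]
    rw [green_succ hP, hφ, switch_of_nonneg hn]
    abel
  have h₂ := backward_solution hQ (φ := φ - green Q (switchOp P Q φ)) fun n hn => by
    simp only [ZeroAtInftyContinuousMap.sub_apply, map_sub]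
    rw [green_succ hQ, hφ, switch_of_neg hn]
    abel
  refine ⟨h₁.1, h₂.1, ?_⟩
  ext1 n
  rcases le_or_gt 0 n with hn | hn
  · rw [glue_of_nonneg hn]
    exact (sub_eq_iff_eq_add'.1 (h₁.2 n hn))
  · rw [glue_of_neg hn]
    exact (sub_eq_iff_eq_add'.1 (h₂.2 n hn.le))

theorem jump_switchOp (φ : EllZero d) : φ 0 - green P (switchOp P Q φ) 0 -
    (φ 0 - green Q (switchOp P Q φ) 0) = jump P Q (switchOp P Q φ) := by
  rw [jump_apply]
  abel

/-- Up to the image of `P` and the kernel of `Q`, the jump takes every value `v`: it does so at the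
sequence whose only nonzero term is `v` at `-1`. -/
theorem exists_jump (hP : ∀ v, P (P v) = P v) (hQ : ∀ v, Q (Q v) = Q v) (v : Rd d) :
    ∃ (ψ : EllZero d) (p q : Rd d), P p = p ∧ Q q = 0 ∧ jump P Q ψ = v + p + q := by
  -- The sequence `θ` solves the equation in backward time and the zero sequence in forward time.
  let θ : EllZero d := cutoff (· = 0) (peak d v)
  have hθ : θ 0 = v := by simp [θ]
  have hθ' n (hn : n ≠ 0) : θ n = 0 := by simp [θ, hn]
  let ψ : EllZero d := leftShift d θ
  have h₁ := forward_solution hP (φ := green P ψ) fun n hn => by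
    rw [green_succ hP, leftShift_apply, hθ' _ (by omega), add_zero]
  have h₂ := backward_solution hQ (φ := green Q ψ - θ) fun n hn => by
    simp only [ZeroAtInftyContinuousMap.sub_apply, map_sub]
    rw [green_succ hQ, leftShift_apply, hθ' n hn.ne, map_zero]
    abel
  refine ⟨ψ, -green P ψ 0, (green Q ψ - θ) 0, by rw [map_neg, h₁.1], h₂.1, ?_⟩
  rw [jump_apply, ZeroAtInftyContinuousMap.sub_apply, hθ]
  abel

/-- The sequences supported at `-1`. -/
def supportedAtNegOne (d : ℕ) : Submodule ℝ (EllZero d) where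
  carrier := {φ | ∀ n, n ≠ -1 → φ n = 0}
  add_mem' := fun ha hb n hn => by
    rw [ZeroAtInftyContinuousMap.add_apply, ha n hn, hb n hn, add_zero]
  zero_mem' := fun _ _ => rfl
  smul_mem' := fun c φ h n hn => by
    rw [ZeroAtInftyContinuousMap.smul_apply, h n hn, smul_zero]

instance : FiniteDimensional ℝ (supportedAtNegOne d) := by
  refine FiniteDimensional.of_injective
    ((eval (-1) : EllZero d →L[ℝ] Rd d).toLinearMap ∘ₗ (supportedAtNegOne d).subtype) ?_
  intro φ ψ h
  ext n : 2
  by_cases hn : n = -1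
  · exact hn ▸ h
  · exact (φ.2 n hn).trans (ψ.2 n hn).symm

theorem sub_switchOp_glue_mem (hP : ∀ v, P (P v) = P v) (hQ : ∀ v, Q (Q v) = Q v)
    (ψ : EllZero d) : switchOp P Q (glue P Q ψ 0 0) - ψ ∈ supportedAtNegOne d := fun n hn => by
  rw [ZeroAtInftyContinuousMap.sub_apply,
    switchOp_glue_apply hP hQ ψ (map_zero P) (map_zero Q) (.inl hn), sub_self]

theorem isFredholm_switchOp (hP : ∀ v, P (P v) = P v) (hQ : ∀ v, Q (Q v) = Q v) :
    (switchOp P Q).IsFredholm := by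
  -- The quasi-inverse ignores the matching condition at the origin.
  let T : EllZero d →L[ℝ] EllZero d := cutoff (0 ≤ ·) ∘L green P + cutoff (· < 0) ∘L green Q
  have hT ψ : T ψ = glue P Q ψ 0 0 := by simp [T, glue]
  let K : Rd d × Rd d →ₗ[ℝ] EllZero d :=
    ((cutoff (0 ≤ ·) ∘L peak d).coprod (cutoff (· < 0) ∘L peak d) :
      Rd d × Rd d →L[ℝ] EllZero d).toLinearMap
  have hK ψ p q : glue P Q ψ p q = T ψ + K (p, q) := by
    have hKa : K (p, q) = cutoff (0 ≤ ·) (peak d p) + cutoff (· < 0) (peak d q) := rfl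
    have hTa : T ψ = cutoff (0 ≤ ·) (green P ψ) + cutoff (· < 0) (green Q ψ) := rfl
    rw [hKa, hTa, glue, map_add, map_add]
    abel
  refine .of_isQuasiInverse (v := T) ⟨?_, ?_⟩
  · refine LinearMap.FiniteRangeSetoid.equiv_iff_hasFiniteRange.2 ?_
    have hle : LinearMap.range (T.toLinearMap ∘ₗ (switchOp P Q).toLinearMap - .id) ≤
        LinearMap.range K := by
      rintro _ ⟨φ, rfl⟩
      have h := (eq_glue hP hQ φ).2.2
      rw [hK] at h
      refine ⟨-(φ 0 - green P (switchOp P Q φ) 0, φ 0 - green Q (switchOp P Q φ) 0), ?_⟩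
      rw [map_neg, neg_eq_iff_eq_neg]
      exact (eq_sub_of_add_eq' h.symm).trans (neg_sub _ _).symm
    exact LinearMap.hasFiniteRange_iff_range.2
      (Submodule.fg_iff_finiteDimensional _ |>.2 (Submodule.finiteDimensional_of_le hle))
  · refine LinearMap.FiniteRangeSetoid.equiv_iff_hasFiniteRange.2 ?_
    have hle : LinearMap.range ((switchOp P Q).toLinearMap ∘ₗ T.toLinearMap - .id) ≤
        supportedAtNegOne d := by
      rintro _ ⟨ψ, rfl⟩
      have h := sub_switchOp_glue_mem hP hQ ψ
      rwa [← hT] at h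
    exact LinearMap.hasFiniteRange_iff_range.2
      (Submodule.fg_iff_finiteDimensional _ |>.2 (Submodule.finiteDimensional_of_le hle))

end Switch

/-! ### The index bundle -/

section Index

variable {Λ : Type*} [TopologicalSpace Λ] {d : ℕ}

theorem equicontinuous_switch {P Q : Λ → Rd d →L[ℝ] Rd d} (hP : Continuous P)
    (hQ : Continuous Q) : Equicontinuous fun (n : ℤ) x => switch (P x) (Q x) n := by
  intro x₀ U hU
  have hP' := (continuous_hyperbolic.comp hP).continuousAt (x := x₀)
  have hQ' := (continuous_hyperbolic.comp hQ).continuousAt (x := x₀)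
  filter_upwards [hP' (UniformSpace.ball_mem_nhds _ hU), hQ' (UniformSpace.ball_mem_nhds _ hU)]
    with x h₁ h₂ n
  simp only [switch]
  split_ifs
  exacts [h₁, h₂]

theorem continuous_switchOp {P Q : Λ → Rd d →L[ℝ] Rd d} (hP : Continuous P)
    (hQ : Continuous Q) : Continuous fun x => switchOp (P x) (Q x) := by
  simp only [switchOp_eq]
  exact continuous_const.clm_sub (.clm_add
    (continuous_const.clm_comp (continuous_pointwise.comp (continuous_hyperbolic.comp hP)))
    (continuous_const.clm_comp (continuous_pointwise.comp (continuous_hyperbolic.comp hQ))))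

theorem continuous_jump {P Q : Λ → Rd d →L[ℝ] Rd d} (hP : Continuous P)
    (hQ : Continuous Q) : Continuous fun x => jump (P x) (Q x) :=
  continuous_const.clm_comp ((continuous_green.comp hQ).clm_sub (continuous_green.comp hP))

theorem continuous_glue {P Q : Λ → Rd d →L[ℝ] Rd d} (hP : Continuous P)
    (hQ : Continuous Q) {Z : Type*} [TopologicalSpace Z] {b : Z → Λ} (hb : Continuous b)
    {ψ : Z → EllZero d} (hψ : Continuous ψ) {p q : Z → Rd d} (hp : Continuous p)
    (hq : Continuous q) : Continuous fun z => glue (P (b z)) (Q (b z)) (ψ z) (p z) (q z) := by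
  have h₁ := ((continuous_green.comp (hP.comp hb)).clm_apply hψ).add
    ((peak d).continuous.comp hp)
  have h₂ := ((continuous_green.comp (hQ.comp hb)).clm_apply hψ).add
    ((peak d).continuous.comp hq)
  exact ((cutoff (0 ≤ ·)).continuous.comp h₁).add ((cutoff (· < 0)).continuous.comp h₂)

/-- The value at the origin of `φ` minus the Green solution for its image under `S - switch P Q`;
`G` is the Green operator in question. -/
noncomputable def startValue (P Q : Rd d →L[ℝ] Rd d) (G : EllZero d →L[ℝ] EllZero d) :
    EllZero d →L[ℝ] Rd d :=
  eval 0 ∘L (.id ℝ _ - G ∘L switchOp P Q)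

theorem continuous_startValue {P Q : Λ → Rd d →L[ℝ] Rd d} (hP : Continuous P)
    (hQ : Continuous Q) {G : Λ → EllZero d →L[ℝ] EllZero d} (hG : Continuous G) :
    Continuous fun x => startValue (P x) (Q x) (G x) :=
  continuous_const.clm_comp
    (continuous_const.clm_sub (hG.clm_comp (continuous_switchOp hP hQ)))

theorem startValue_apply (P Q : Rd d →L[ℝ] Rd d) (G : EllZero d →L[ℝ] EllZero d)
    (φ : EllZero d) : startValue P Q G φ = φ 0 - G (switchOp P Q φ) 0 := rfl

/-- The matching data `(v, p, q)` at the origin, for right-hand sides `v ∈ V`. -/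
noncomputable abbrev matchingData (E F : Submodule ℝ (Rd d)) (V : Submodule ℝ (EllZero d)) :
    Submodule ℝ (V × Rd d × Rd d) :=
  matchingSpace (V := V) E F (jump E.starProjection F.starProjection ∘L V.subtypeL)

theorem switchOp_glue_of_mem {E F : Submodule ℝ (Rd d)} {V : Submodule ℝ (EllZero d)}
    {y : V × Rd d × Rd d} (hy : y ∈ matchingData E F V) :
    switchOp E.starProjection F.starProjection
      (glue E.starProjection F.starProjection y.1 y.2.1 y.2.2) = (y.1 : EllZero d) := by
  ext1 n
  exact switchOp_glue_apply E.starProjection_idem F.starProjection_idem _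
    (Submodule.starProjection_eq_self_iff.2 hy.1)
    (F.starProjection_apply_eq_zero_iff.2 hy.2.1) (.inr hy.2.2)

/-- If `V` is transversal to `S - switch P Q`, then `p - q - jump v` takes every value. -/
theorem exists_sub_sub_jump {E F : Submodule ℝ (Rd d)} {V : Submodule ℝ (EllZero d)}
    (hV : LinearMap.range (switchOp E.starProjection F.starProjection).toLinearMap ⊔ V = ⊤)
    (h : Rd d) : ∃ v : V, ∃ p ∈ E, ∃ q ∈ Fᗮ,
      p - q - (jump E.starProjection F.starProjection ∘L V.subtypeL) v = h := by
  obtain ⟨ψ, p, q, hp, hq, hψ⟩ := exists_jump E.starProjection_idem F.starProjection_idem (-h)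
  obtain ⟨_, ⟨φ, rfl⟩, v, hv, rfl⟩ := Submodule.mem_sup.1 (hV ▸ Submodule.mem_top (x := ψ))
  have hφ := eq_glue E.starProjection_idem F.starProjection_idem φ
  have hj := jump_switchOp (P := E.starProjection) (Q := F.starProjection) φ
  refine ⟨⟨v, hv⟩, p - _, E.sub_mem (Submodule.starProjection_eq_self_iff.1 hp)
      (Submodule.starProjection_eq_self_iff.1 hφ.1), -(q + _),
    neg_mem (add_mem (F.starProjection_apply_eq_zero_iff.1 hq)
      (F.starProjection_apply_eq_zero_iff.1 hφ.2.1)), ?_⟩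
  rw [map_add] at hψ
  change _ - _ - jump _ _ v = h
  rw [eq_sub_of_add_eq' hψ]
  change _ - (_ + _ + _ - jump _ _ (switchOp _ _ φ)) = h
  rw [← hj]
  abel

/-- The image of a sequence under `S - switch P Q`, with its two starting values. -/
noncomputable def solutionMap (E F : Submodule ℝ (Rd d)) (V : Submodule ℝ (EllZero d)) :
    V.comap (switchOp E.starProjection F.starProjection).toLinearMap →ₗ[ℝ] V × Rd d × Rd d :=
  let L := switchOp E.starProjection F.starProjection
  let W := V.comap L.toLinearMap
  (LinearMap.codRestrict V (L.toLinearMap ∘ₗ W.subtype) fun φ => φ.2).prod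
    (((startValue E.starProjection F.starProjection (green E.starProjection)).toLinearMap ∘ₗ
      W.subtype).prod
    ((startValue E.starProjection F.starProjection (green F.starProjection)).toLinearMap ∘ₗ
      W.subtype))

theorem solutionMap_mem (E F : Submodule ℝ (Rd d)) (V : Submodule ℝ (EllZero d))
    (φ : V.comap (switchOp E.starProjection F.starProjection).toLinearMap) :
    solutionMap E F V φ ∈ matchingData E F V := by
  have h := eq_glue E.starProjection_idem F.starProjection_idem (φ : EllZero d)
  exact ⟨Submodule.starProjection_eq_self_iff.1 h.1,
    F.starProjection_apply_eq_zero_iff.1 h.2.1, jump_switchOp _⟩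

theorem glue_solutionMap (E F : Submodule ℝ (Rd d)) (V : Submodule ℝ (EllZero d))
    (φ : V.comap (switchOp E.starProjection F.starProjection).toLinearMap) :
    glue E.starProjection F.starProjection (solutionMap E F V φ).1 (solutionMap E F V φ).2.1
      (solutionMap E F V φ).2.2 = φ :=
  (eq_glue E.starProjection_idem F.starProjection_idem (φ : EllZero d)).2.2.symm

theorem startValue_glue {E F : Submodule ℝ (Rd d)} {V : Submodule ℝ (EllZero d)}
    {y : V × Rd d × Rd d} (hy : y ∈ matchingData E F V) :
    startValue E.starProjection F.starProjection (green E.starProjection)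
        (glue E.starProjection F.starProjection y.1 y.2.1 y.2.2) = y.2.1 ∧
      startValue E.starProjection F.starProjection (green F.starProjection)
        (glue E.starProjection F.starProjection y.1 y.2.1 y.2.2) = y.2.2 := by
  have h₁ := switchOp_glue_of_mem hy
  have h₂ : glue E.starProjection F.starProjection y.1 y.2.1 y.2.2 0 =
      green E.starProjection y.1 0 + y.2.1 := by
    rw [glue_of_nonneg le_rfl]
    simp
  have h₃ : y.2.1 - y.2.2 =
      green F.starProjection y.1 0 - green E.starProjection y.1 0 := hy.2.2
  rw [startValue_apply, startValue_apply, h₁, h₂]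
  refine ⟨add_sub_cancel_left _ _, ?_⟩
  rw [sub_eq_sub_iff_add_eq_add] at h₃
  rw [sub_eq_iff_eq_add, add_comm, h₃, add_comm]

/-- Over a subspace `V` of right-hand sides, the solutions of `φ (n + 1) = switch P Q n (φ n) + v n`
are parametrized by `v ∈ V` and the matching data at the origin. -/
noncomputable def solutionEquiv (E F : Submodule ℝ (Rd d)) (V : Submodule ℝ (EllZero d)) :
    V.comap (switchOp E.starProjection F.starProjection).toLinearMap ≃ₗ[ℝ]
      matchingData E F V :=
  { LinearMap.codRestrict _ (solutionMap E F V) (solutionMap_mem E F V) with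
    invFun := fun y => ⟨glue E.starProjection F.starProjection y.1.1 y.1.2.1 y.1.2.2,
      (congrArg (· ∈ V) (switchOp_glue_of_mem y.2)).mpr y.1.1.2⟩
    left_inv := fun φ => Subtype.ext (glue_solutionMap E F V φ)
    right_inv := fun y => Subtype.ext (Prod.ext (Subtype.ext (switchOp_glue_of_mem y.2))
      (Prod.ext (startValue_glue y.2).1 (startValue_glue y.2).2)) }

theorem continuous_solutionEquiv {E F : Λ → Submodule ℝ (Rd d)}
    (hP : Continuous fun x => (E x).starProjection)
    (hQ : Continuous fun x => (F x).starProjection) (V : Submodule ℝ (EllZero d)) :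
    Continuous[subTopology (transversalPreimage
      (fun x => switchOp (E x).starProjection (F x).starProjection) V), _]
      fun p : FamTotal fun x => transversalPreimage
        (fun x => switchOp (E x).starProjection (F x).starProjection) V x =>
        (solutionEquiv (E p.proj) (F p.proj) V p.snd : V × Rd d × Rd d) := by
  let _ := subTopology (transversalPreimage
    (fun x => switchOp (E x).starProjection (F x).starProjection) V)
  have hd : Continuous fun p : FamTotal fun x => transversalPreimage
      (fun x => switchOp (E x).starProjection (F x).starProjection) V x =>
      (p.proj, (p.snd : EllZero d)) := continuous_induced_dom
  exact (((continuous_switchOp hP hQ).comp hd.fst).clm_apply hd.snd).subtype_mk _ |>.prodMk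
    ((((continuous_startValue hP hQ (continuous_green.comp hP)).comp hd.fst).clm_apply
      hd.snd).prodMk
    (((continuous_startValue hP hQ (continuous_green.comp hQ)).comp hd.fst).clm_apply hd.snd))

theorem continuous_solutionEquiv_symm {E F : Λ → Submodule ℝ (Rd d)}
    (hP : Continuous fun x => (E x).starProjection)
    (hQ : Continuous fun x => (F x).starProjection) (V : Submodule ℝ (EllZero d)) :
    Continuous[subTopology (X := V × Rd d × Rd d) (fun x => matchingData (E x) (F x) V), _]
      fun p : FamTotal fun x => matchingData (E x) (F x) V =>
        ((solutionEquiv (E p.proj) (F p.proj) V).symm p.snd : EllZero d) := by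
  let _ := subTopology (X := V × Rd d × Rd d) (fun x => matchingData (E x) (F x) V)
  have hd : Continuous fun p : FamTotal fun x => matchingData (E x) (F x) V =>
      (p.proj, (p.snd : V × Rd d × Rd d)) := continuous_induced_dom
  exact continuous_glue hP hQ hd.fst (continuous_subtype_val.comp hd.snd.fst) hd.snd.snd.fst
    hd.snd.snd.snd

end Index

theorem mainTheorem5 {Λ : Type*} [TopologicalSpace Λ] [CompactSpace Λ] (d : ℕ)
    (E F : Λ → Submodule ℝ (Rd d)) (hE : IsSubbundle E) (hF : IsSubbundle F) :
    ∃ A : LinearVectorField Λ d,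
      (∀ x n, IsUnit (A.toFun x n)) ∧
      Continuous A.operator ∧
      (∀ x, (A.operator x).IsFredholm) ∧
      IsIndexBundle A.operator (hE.toBundle.toKO - hF.toBundle.toKO) := by
  let P x := (E x).starProjection
  let Q x := (F x).starProjection
  have hP : Continuous P := hE.continuous_starProjection
  have hQ : Continuous Q := hF.continuous_starProjection
  have hPi x v : P x (P x v) = P x v := (E x).starProjection_idem v
  have hQi x v : Q x (Q x v) = Q x v := (F x).starProjection_idem v
  have hL : Continuous fun x => switchOp (P x) (Q x) := continuous_switchOp hP hQ
  refine ⟨⟨fun x => switch (P x) (Q x), equicontinuous_switch hP hQ,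
    fun x => exists_norm_switch_le (P x) (Q x)⟩, fun x n => ?_, hL,
    fun x => isFredholm_switchOp (hPi x) (hQi x),
    ⟨supportedAtNegOne d, inferInstance, fun x => ?_⟩, fun V _ hV => ?_⟩
  · change IsUnit (switch (P x) (Q x) n)
    unfold switch
    split_ifs
    exacts [isUnit_hyperbolic (hPi x), isUnit_hyperbolic (hQi x)]
  · refine eq_top_iff.2 fun ψ _ => ?_
    have h := sub_switchOp_glue_mem (hPi x) (hQi x) ψ
    exact Submodule.mem_sup.2 ⟨_, ⟨glue (P x) (Q x) ψ 0 0, rfl⟩, _, neg_mem h, by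
      rw [neg_sub]
      exact add_sub_cancel _ _⟩
  · replace hV x : LinearMap.range (switchOp (P x) (Q x)).toLinearMap ⊔ V = ⊤ := hV x
    have hc : Continuous fun x => jump (P x) (Q x) ∘L V.subtypeL :=
      (continuous_jump hP hQ).clm_comp continuous_const
    -- Replace `E(L, V)` by the bundle of matching data.
    obtain ⟨hM, hKO⟩ := isSubbundle_matchingSpace hE hF hc fun x =>
      exists_sub_sub_jump (hV x)
    obtain ⟨hS, hS'⟩ := hM.exists_toKO_eq_of_equiv (fun x => solutionEquiv (E x) (F x) V)
      (S := transversalPreimage (fun x => switchOp (P x) (Q x)) V)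
      (continuous_solutionEquiv hP hQ V) (continuous_solutionEquiv_symm hP hQ V)
    have h : hE.toBundle.toKO - hF.toBundle.toKO =
        hS.toBundle.toKO - (RealVectorBundle.trivialBundle Λ V).toKO := by
      rw [hS', sub_eq_sub_iff_add_eq_add, ← hKO]
    exact ⟨hS, h⟩
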